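/- Fix a partition function $\chi$, i.e. $\chi\in C^\infty(\mathbb R)$ with $\chi(x)=0$ for $x\le 0$, $\chi(x)=1$ for $x\ge 1$ and $\chi'\ge 0$. Subscripts $x,\xi$ denote weak derivatives, and elements of $H^1(\mathbb R)$ are identified with their continuous representatives. Let $H_{0,\infty}=\{\bar u+c\chi : \bar u\in H^1(\mathbb R),\ c\in\mathbb R\}$ and $V=\{f\in C(\mathbb R)\cap L^\infty(\mathbb R) : f_\xi\in L^2(\mathbb R)\}$. Eulerian coordinates: let $\mathcal D$ be the set of pairs $(u,\mu)$ where $u\in H_{0,\infty}$ and $\mu$ is a positive finite Radon measure on $\mathbb R$ whose absolutely continuous part is $\mu_{ac}=u_x^2\,dx$. Lagrangian coordinates: let $\mathcal G$ be the set of triples $(y,U,h)$ such that, with $\zeta(\xi)=y(\xi)-\xi$, one has $\zeta\in V\cap W^{1,\infty}(\mathbb R)$, $U\in H_{0,\infty}\cap W^{1,\infty}(\mathbb R)$, $h\in L^2(\mathbb R)\cap L^\infty(\mathbb R)$, and almost everywhere $y_\xi\ge 0$, $h\ge 0$, $y_\xi+h>0$ and $y_\xi h=U_\xi^2$. Let $G$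 be the set of homeomorphisms $f$ of $\mathbb R$ such that $f-\mathrm{id}$ and $f^{-1}-\mathrm{id}$ belong to $W^{1,\infty}(\mathbb R)$ and $f_\xi-1\in L^2(\mathbb R)$. Let $\mathcal F$ be the set of $(y,U,h)\in\mathcal G$ with $y+H\in G$, where $H(\xi)=\int_{-\infty}^{\xi}h(\tau)\,d\tau$. For $X,X'\in\mathcal F$ write $X\sim X'$ if $X'=X\circ f:=(y\circ f,\,U\circ f,\,(h\circ f)f_\xi)$ for some $f\in G$ (functions $h$ being identified when they agree almost everywhere). Theorem. The relation $\sim$ is an equivalence relation on $\mathcal F$; let $\mathcal F/G$ be the quotient and $[X]$ the class of $X$. The following two maps are well defined. (i) $L:\mathcal D\to\mathcal F/G$, $L(u,\mu)=[(y,U,h)]$, where $$y(\xi)=\sup\{x : \mu((-\infty,x))+x<\xi\},\qquad U=u\circ y,\qquad h=1-y_\xi ;$$ in particular $(y,U,h)\in\mathcal F$. (ii) $M:\mathcal F/G\to\mathcal D$, $M([(y,U,h)])=(u,\mu)$, where $u(x)=U(\xi)$ for any $\xi$ such that $x=y(\xi)$, and $\mu=y_\#(h\,d\xi)$; in particular $(u,\mu)\in\mathcal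 D$, and it does not depend on the choice of $\xi$ or of the representative. Moreover, $L$ and $M$ are mutually inverse: $$L\circ M=\mathrm{id}_{\mathcal F/G},\qquad M\circ L=\mathrm{id}_{\mathcal D}.$$ -/

import Mathlib

open MeasureTheory Set
open scoped ContDiff ENNReal

noncomputable section

namespace CamassaHolm

/-- `g` is a weak derivative of `f` on the real line. -/
def HasWeakDeriv (f g : ℝ → ℝ) : Prop :=
  LocallyIntegrable f volume ∧ LocallyIntegrable g volume ∧
    ∀ φ : ℝ → ℝ, ContDiff ℝ ∞ φ → HasCompactSupport φ →
      ∫ x, f x * deriv φ x = -∫ x, g x * φ x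

open Classical in
/-- The weak derivative of `f`, determined up to a null set; it is only used for functions that
have one (and is `0` otherwise). -/
def weakDeriv (f : ℝ → ℝ) : ℝ → ℝ :=
  if hf : ∃ g, HasWeakDeriv f g then hf.choose else 0

theorem hasWeakDeriv_weakDeriv {f : ℝ → ℝ} (hf : ∃ g, HasWeakDeriv f g) :
    HasWeakDeriv f (weakDeriv f) := by
  unfold weakDeriv
  rw [dif_pos hf]
  exact hf.choose_spec

/-- Weak derivatives are unique up to null sets. -/
theorem HasWeakDeriv.weakDeriv_ae_eq {f g : ℝ → ℝ} (hg : HasWeakDeriv f g) :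
    weakDeriv f =ᵐ[volume] g := by
  have hw := hasWeakDeriv_weakDeriv ⟨g, hg⟩
  refine ae_eq_of_integral_contDiff_smul_eq hw.2.1 hg.2.1 fun φ hφ hc => ?_
  have h1 := hw.2.2 φ hφ hc
  have h2 := hg.2.2 φ hφ hc
  simp only [smul_eq_mul, mul_comm (φ _)]
  linarith

/-- A partition function: smooth, nondecreasing, `0` on `(-∞, 0]` and `1` on `[1, ∞)`. -/
structure IsPartitionFunction (χ : ℝ → ℝ) : Prop where
  contDiff : ContDiff ℝ ∞ χ
  eq_zero : ∀ x ≤ 0, χ x = 0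
  eq_one : ∀ x, 1 ≤ x → χ x = 1
  deriv_nonneg : ∀ x, 0 ≤ deriv χ x

/-- `H¹(ℝ)`; its elements are identified with their continuous representatives. -/
def MemH1 (f : ℝ → ℝ) : Prop :=
  Continuous f ∧ MemLp f 2 volume ∧ ∃ g, HasWeakDeriv f g ∧ MemLp g 2 volume

/-- `W^{1,∞}(ℝ)`. -/
def MemW1Inf (f : ℝ → ℝ) : Prop :=
  MemLp f ∞ volume ∧ ∃ g, HasWeakDeriv f g ∧ MemLp g ∞ volume

/-- `V`: bounded continuous functions with weak derivative in `L²(ℝ)`. -/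
def MemV (f : ℝ → ℝ) : Prop :=
  Continuous f ∧ MemLp f ∞ volume ∧ ∃ g, HasWeakDeriv f g ∧ MemLp g 2 volume

/-- `H_{0,∞}(ℝ)`: functions `ū + c χ` with `ū ∈ H¹(ℝ)` and `c ∈ ℝ`. -/
def MemH0Inf (χ u : ℝ → ℝ) : Prop :=
  ∃ (v : ℝ → ℝ) (c : ℝ), MemH1 v ∧ ∀ x, u x = v x + c * χ x

/-- The set `𝒟` of Eulerian coordinates: pairs `(u, μ)` with `u ∈ H_{0,∞}(ℝ)` and `μ` a finite
positive Borel (hence Radon) measure whose absolutely continuous part is `u_x² dx`. -/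
structure Eulerian (χ : ℝ → ℝ) where
  u : ℝ → ℝ
  μ : Measure ℝ
  u_mem : MemH0Inf χ u
  finite : IsFiniteMeasure μ
  ac_part : volume.withDensity (μ.rnDeriv volume) =
    volume.withDensity (fun x => ENNReal.ofReal (weakDeriv u x ^ 2))

/-- A triple `(y, U, h)` of functions; `h` stands for its class modulo null sets. -/
structure Triple where
  y : ℝ → ℝ
  U : ℝ → ℝ
  h : ℝ → ℝ

/-- Membership of `(y, U, h)`, with `y = id + ζ`, in the set `𝒢`. The first three fields say
that `(ζ, U, h)` belongs to `E = V × H_{0,∞}(ℝ) × L²(ℝ)`. -/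
structure MemCalG (χ : ℝ → ℝ) (X : Triple) : Prop where
  zeta_mem : MemV (fun ξ => X.y ξ - ξ)
  U_mem : MemH0Inf χ X.U
  h_mem : MemLp X.h 2 volume
  zeta_W1Inf : MemW1Inf (fun ξ => X.y ξ - ξ)
  U_W1Inf : MemW1Inf X.U
  h_bounded : MemLp X.h ∞ volume
  y_deriv_nonneg : ∀ᵐ ξ, 0 ≤ weakDeriv X.y ξ
  h_nonneg : ∀ᵐ ξ, 0 ≤ X.h ξ
  add_pos : ∀ᵐ ξ, 0 < weakDeriv X.y ξ + X.h ξ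
  energy : ∀ᵐ ξ, weakDeriv X.y ξ * X.h ξ = weakDeriv X.U ξ ^ 2

/-- Membership of a homeomorphism of the line in the relabeling group `G`. -/
structure IsRelabeling (f : ℝ ≃ₜ ℝ) : Prop where
  sub_id : MemW1Inf (fun ξ => f ξ - ξ)
  symm_sub_id : MemW1Inf (fun ξ => f.symm ξ - ξ)
  deriv_sub_one : MemLp (fun ξ => weakDeriv f ξ - 1) 2 volume

/-- Membership in `ℱ`: `X ∈ 𝒢` and `y + H ∈ G`, where `H(ξ) = ∫_{-∞}^ξ h`. -/
def MemF (χ : ℝ → ℝ) (X : Triple) : Prop :=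
  MemCalG χ X ∧
    ∃ f : ℝ ≃ₜ ℝ, IsRelabeling f ∧ ∀ ξ, f ξ = X.y ξ + ∫ t in Iic ξ, X.h t

/-- The set `ℱ` of Lagrangian coordinates. -/
def Lagrangian (χ : ℝ → ℝ) : Type := {X : Triple // MemF χ X}

/-- `X' = X ∘ f` for some relabeling `f ∈ G`, where `X ∘ f = (y ∘ f, U ∘ f, (h ∘ f) f_ξ)`. -/
def Relabeled (χ : ℝ → ℝ) (X X' : Lagrangian χ) : Prop :=
  ∃ f : ℝ ≃ₜ ℝ, IsRelabeling f ∧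
    (∀ ξ, X'.1.y ξ = X.1.y (f ξ)) ∧ (∀ ξ, X'.1.U ξ = X.1.U (f ξ)) ∧
    ∀ᵐ ξ, X'.1.h ξ = X.1.h (f ξ) * weakDeriv f ξ

/-- The quotient `ℱ/G`. -/
def LagrangianModG (χ : ℝ → ℝ) : Type := Quot (Relabeled χ)

/-- `y(ξ) = sup {x | μ((-∞, x)) + x < ξ}`. -/
def characteristic (μ : Measure ℝ) (ξ : ℝ) : ℝ :=
  sSup {x : ℝ | μ.real (Iio x) + x < ξ}

/-- The triple `(y, U, h)` attached to `(u, μ)`: `y` as above, `U = u ∘ y`, `h = 1 - y_ξ`. -/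
def toTriple (u : ℝ → ℝ) (μ : Measure ℝ) : Triple where
  y := characteristic μ
  U := fun ξ => u (characteristic μ ξ)
  h := fun ξ => 1 - weakDeriv (characteristic μ) ξ

/-- `L : 𝒟 → ℱ/G` is the map from Eulerian to Lagrangian coordinates: for every `(u, μ) ∈ 𝒟` the
triple above lies in `ℱ`, and `L (u, μ)` is its class. -/
def IsEulerToLagrange (χ : ℝ → ℝ) (L : Eulerian χ → LagrangianModG χ) : Prop :=
  ∀ d : Eulerian χ, ∃ hX : MemF χ (toTriple d.u d.μ),
    L d = Quot.mk (Relabeled χ) ⟨toTriple d.u d.μ, hX⟩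

/-- `M : ℱ/G → 𝒟` is the map from Lagrangian to Eulerian coordinates: for every `(y, U, h) ∈ ℱ`,
the pair `(u, μ) = M [(y, U, h)]` satisfies `u(x) = U(ξ)` whenever `x = y(ξ)`, and
`μ = y_# (h dξ)`. -/
def IsLagrangeToEuler (χ : ℝ → ℝ) (M : LagrangianModG χ → Eulerian χ) : Prop :=
  ∀ X : Lagrangian χ,
    (∀ x ξ, x = X.1.y ξ → (M (Quot.mk (Relabeled χ) X)).u x = X.1.U ξ) ∧
    (M (Quot.mk (Relabeled χ) X)).μ =
      (volume.withDensity (fun ξ => ENNReal.ofReal (X.1.h ξ))).map X.1.y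

end CamassaHolm

end

open MeasureTheory Set
open scoped ContDiff ENNReal

noncomputable section

namespace CamassaHolm

open Filter Topology
open scoped NNReal

/-! A Lagrangian triple is a monotone Lipschitz parametrisation `y` of the line carrying the energy
`h dξ`. The image of `{y_ξ = 0}` under `y` is Lebesgue null, so the energy sitting there becomes the
singular part of `μ`. On the complement, `y_ξ h = U_ξ²` together with the change of variables `x =
y(ξ)` gives the density `u_x²`, where `u_x = U_ξ / y_ξ`. Hence `M` lands in `𝒟`
(`eulerMeasure_eq_add`, `isPrimitive_eulerVelocity`), and reparametrising by `f` changes neither `u`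
nor the pushforward.

Conversely, `characteristic` is the generalised inverse of the distribution function of `μ + dx`:
`y(ξ)` is the only point whose jump interval `[lowerDistrib, upperDistrib]` contains `ξ`. It is
monotone, 1-Lipschitz and transports `dξ` to `dx + μ`. Since `y_ξ dξ` is transported to `dx`, the
remainder `(1 - y_ξ) dξ` is transported to `μ`, which is `M ∘ L = id` on measures. The energy
identity for `L` comes from `y_ξ (u_x² + 1) = 1` at points mapped to good `x`; elsewhere `y_ξ = 0`,
which forces `U_ξ = 0`. Here `y + H` is the identity, so the triple lies in `ℱ`.

For `L ∘ M`, monotonicity of `y` puts `y(ξ) + H(ξ)` in the jump interval of the image measure at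
`y(ξ)`. The characteristic of that measure composed with `f = y + H` is therefore `y`, and `f` is
itself the required relabeling. -/

/-! ### Weak derivatives and absolutely continuous primitives -/

/-- `f` is a primitive of the locally integrable function `g`. -/
structure IsPrimitive (f g : ℝ → ℝ) : Prop where
  locallyIntegrable : LocallyIntegrable g volume
  sub_eq : ∀ a b, f b - f a = ∫ x in a..b, g x

theorem _root_.MeasureTheory.LocallyIntegrable.intervalIntegrable_real {g : ℝ → ℝ}
    (hg : LocallyIntegrable g volume) (a b : ℝ) : IntervalIntegrable g volume a b :=
  intervalIntegrable_iff.mpr <|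
    (hg.integrableOn_isCompact isCompact_uIcc).mono_set uIoc_subset_uIcc

namespace IsPrimitive

variable {f g f₁ g₁ : ℝ → ℝ}

theorem intervalIntegrable (h : IsPrimitive f g) (a b : ℝ) : IntervalIntegrable g volume a b :=
  h.locallyIntegrable.intervalIntegrable_real a b

theorem eq_add (h : IsPrimitive f g) (a : ℝ) : f = fun x => f a + ∫ t in a..x, g t := by
  funext x
  rw [← h.sub_eq a x]; ring

theorem ae_hasDerivAt (h : IsPrimitive f g) : ∀ᵐ x, HasDerivAt f (g x) x := by
  filter_upwards [LocallyIntegrable.ae_hasDerivAt_integral h.locallyIntegrable] with x hx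
  rw [h.eq_add 0]
  exact (hx 0).const_add _

theorem deriv_ae_eq (h : IsPrimitive f g) : deriv f =ᵐ[volume] g := by
  filter_upwards [h.ae_hasDerivAt] with x hx using hx.deriv

theorem absolutelyContinuousOnInterval (h : IsPrimitive f g) (a b : ℝ) :
    AbsolutelyContinuousOnInterval f a b := by
  rw [h.eq_add a]
  exact ((LipschitzWith.const (f a)).lipschitzOnWith.absolutelyContinuousOnInterval).add
    ((h.intervalIntegrable a b).absolutelyContinuousOnInterval_intervalIntegral left_mem_uIcc)

theorem continuous (h : IsPrimitive f g) : Continuous f := by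
  rw [h.eq_add 0]
  exact continuous_const.add (intervalIntegral.continuous_primitive h.intervalIntegrable 0)

theorem congr_ae (h : IsPrimitive f g) (hg : g =ᵐ[volume] g₁) : IsPrimitive f g₁ where
  locallyIntegrable := h.locallyIntegrable.congr hg
  sub_eq a b := by
    rw [h.sub_eq]
    exact intervalIntegral.integral_congr_ae (hg.mono fun x hx _ => hx)

theorem add (h : IsPrimitive f g) (h₁ : IsPrimitive f₁ g₁) :
    IsPrimitive (fun x => f x + f₁ x) (fun x => g x + g₁ x) where
  locallyIntegrable := h.locallyIntegrable.add h₁.locallyIntegrable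
  sub_eq a b := by
    rw [intervalIntegral.integral_add (h.intervalIntegrable a b) (h₁.intervalIntegrable a b),
      ← h.sub_eq, ← h₁.sub_eq]
    ring

theorem const_mul (h : IsPrimitive f g) (c : ℝ) :
    IsPrimitive (fun x => c * f x) (fun x => c * g x) where
  locallyIntegrable := h.locallyIntegrable.smul c
  sub_eq a b := by
    rw [intervalIntegral.integral_const_mul, ← h.sub_eq]
    ring

theorem sub (h : IsPrimitive f g) (h₁ : IsPrimitive f₁ g₁) :
    IsPrimitive (fun x => f x - f₁ x) (fun x => g x - g₁ x) := by
  have := h.add (h₁.const_mul (-1))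
  simpa [sub_eq_add_neg] using this

/-- Integration by parts for absolutely continuous functions, on an interval whose endpoints lie
outside the support of the test function. -/
theorem hasWeakDeriv (h : IsPrimitive f g) : HasWeakDeriv f g := by
  refine ⟨h.continuous.locallyIntegrable, h.locallyIntegrable, fun φ hφ hc => ?_⟩
  obtain ⟨R, hR⟩ := hc.isCompact.isBounded.subset_closedBall 0
  have hout : ∀ x, x ∉ Ioo (-(|R| + 1)) (|R| + 1) → x ∉ tsupport φ := by
    intro x hx hx'
    have h1 := hR hx'
    rw [mem_closedBall_zero_iff, Real.norm_eq_abs] at h1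
    exact hx (abs_lt.mp (by linarith [le_abs_self R]))
  set b := |R| + 1 with hb
  have hsub : ∀ ψ : ℝ → ℝ, Function.support ψ ⊆ tsupport φ →
      Function.support ψ ⊆ Ioc (-b) b := by
    intro ψ hψ x hx
    by_contra hcon
    exact hout x (fun hx' => hcon (Ioo_subset_Ioc_self hx')) (hψ hx)
  have h0 : φ b = 0 := image_eq_zero_of_notMem_tsupport (hout b (by simp))
  have h0' : φ (-b) = 0 := image_eq_zero_of_notMem_tsupport (hout (-b) (by simp))
  have key := (h.absolutelyContinuousOnInterval (-b) b).integral_mul_deriv_eq_deriv_mul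
    ((hφ.of_le (by exact_mod_cast le_top)).contDiffOn.absolutelyContinuousOnInterval)
  rw [intervalIntegral.integral_eq_integral_of_support_subset, h0, h0',
    intervalIntegral.integral_congr_ae (g := fun x => g x * φ x),
    intervalIntegral.integral_eq_integral_of_support_subset] at key
  · simpa using key
  · refine hsub _ fun x hx => subset_tsupport _ ?_
    exact right_ne_zero_of_mul hx
  · filter_upwards [h.deriv_ae_eq] with x hx _
    rw [hx]
  · refine hsub _ fun x hx => support_deriv_subset ?_
    exact right_ne_zero_of_mul hx

theorem weakDeriv_ae_eq (h : IsPrimitive f g) : weakDeriv f =ᵐ[volume] g :=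
  h.hasWeakDeriv.weakDeriv_ae_eq

end IsPrimitive

theorem isPrimitive_intervalIntegral {g : ℝ → ℝ} (hg : LocallyIntegrable g volume) (c : ℝ) :
    IsPrimitive (fun x => ∫ t in c..x, g t) g where
  locallyIntegrable := hg
  sub_eq _ _ := intervalIntegral.integral_interval_sub_left
    (hg.intervalIntegrable_real _ _) (hg.intervalIntegrable_real _ _)

/-- A compactly supported smooth function of integral zero has a compactly supported smooth
primitive. -/
theorem exists_primitive_of_integral_eq_zero {θ : ℝ → ℝ} (hθ : ContDiff ℝ ∞ θ)
    (hc : HasCompactSupport θ) (h0 : ∫ x, θ x = 0) :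
    ∃ φ : ℝ → ℝ, ContDiff ℝ ∞ φ ∧ HasCompactSupport φ ∧ deriv φ = θ := by
  obtain ⟨R, hR⟩ := hc.isCompact.isBounded.subset_closedBall 0
  have hout : ∀ x, R < |x| → θ x = 0 := fun x hx => image_eq_zero_of_notMem_tsupport fun hx' => by
    have h1 := hR hx'
    rw [mem_closedBall_zero_iff, Real.norm_eq_abs] at h1
    linarith
  set a := -(|R| + 1)
  have hd : ∀ x, HasDerivAt (fun x => ∫ t in a..x, θ t) (θ x) x := fun x =>
    intervalIntegral.integral_hasDerivAt_right (hθ.continuous.intervalIntegrable _ _)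
      hθ.continuous.aestronglyMeasurable.stronglyMeasurableAtFilter hθ.continuous.continuousAt
  have hderiv : deriv (fun x => ∫ t in a..x, θ t) = θ := funext fun x => (hd x).deriv
  refine ⟨_, ?_, ?_, hderiv⟩
  · rw [contDiff_infty_iff_deriv, hderiv]
    exact ⟨fun x => (hd x).differentiableAt, hθ⟩
  · refine HasCompactSupport.intro (isCompact_Icc (a := a) (b := -a)) fun x hx => ?_
    rcases lt_or_ge x a with hxa | hxa
    · refine (intervalIntegral.integral_congr (g := fun _ => 0) fun t ht => ?_).trans (by simp)
      rw [uIcc_of_ge hxa.le] at ht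
      refine hout t ?_
      have := neg_abs_le t
      have := neg_le_abs t
      have := le_abs_self R
      have := ht.2
      simp only [a] at *
      linarith
    · have hxa' : -a < x := by
        by_contra hcon
        exact hx ⟨hxa, not_lt.mp hcon⟩
      rw [intervalIntegral.integral_eq_integral_of_support_subset, h0]
      intro t ht
      have : |t| ≤ R := by
        by_contra hcon
        exact ht (hout t (not_le.mp hcon))
      have := le_abs_self R
      have h1 := abs_le.mp ‹|t| ≤ R›
      simp only [a] at *
      constructor <;> linarith [h1.1, h1.2]

/-- A locally integrable function with zero weak derivative is constant. -/
theorem ae_const_of_integral_mul_deriv_eq_zero {w : ℝ → ℝ} (hw : LocallyIntegrable w volume)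
    (h : ∀ φ : ℝ → ℝ, ContDiff ℝ ∞ φ → HasCompactSupport φ → ∫ x, w x * deriv φ x = 0) :
    ∃ c : ℝ, w =ᵐ[volume] fun _ => c := by
  let B : ContDiffBump (0 : ℝ) := ⟨1, 2, by norm_num, by norm_num⟩
  set ρ : ℝ → ℝ := B.normed volume with hρ
  have hρs : ContDiff ℝ ∞ ρ := B.contDiff_normed
  have hρc : HasCompactSupport ρ := B.hasCompactSupport_normed
  have hρi : ∫ x, ρ x = 1 := B.integral_normed
  have hint : ∀ ψ : ℝ → ℝ, ContDiff ℝ ∞ ψ → HasCompactSupport ψ →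
      Integrable (fun x => w x * ψ x) volume := fun ψ hψ hψc => by
    have := hw.integrable_smul_left_of_hasCompactSupport hψ.continuous hψc
    simpa [mul_comm] using this
  refine ⟨∫ x, w x * ρ x, ae_eq_of_integral_contDiff_smul_eq hw (locallyIntegrable_const _) ?_⟩
  intro ψ hψ hψc
  have hψi : Integrable ψ volume := hψ.continuous.integrable_of_hasCompactSupport hψc
  have hρi' : Integrable ρ volume := hρs.continuous.integrable_of_hasCompactSupport hρc
  -- Subtracting the right multiple of the unit-mass bump `ρ` makes the test function mean-free,
  -- hence a derivative of a test function.
  obtain ⟨φ, hφ, hφc, hφd⟩ := exists_primitive_of_integral_eq_zero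
    (θ := fun x => ψ x - (∫ t, ψ t) * ρ x) (hψ.sub (contDiff_const.mul hρs))
    (hψc.sub hρc.mul_left)
    (by rw [integral_sub hψi (hρi'.const_mul _), integral_const_mul, hρi]; ring)
  have h1 := h φ hφ hφc
  rw [hφd] at h1
  have h2 : ∫ x, w x * ψ x = (∫ t, ψ t) * ∫ x, w x * ρ x := by
    rw [← integral_const_mul, ← sub_eq_zero, ← h1,
      ← integral_sub (hint ψ hψ hψc) ((hint ρ hρs hρc).const_mul _)]
    congr 1
    funext x
    ring
  simp only [smul_eq_mul]
  rw [integral_mul_const, ← h2]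
  simp only [mul_comm]

/-- The difference between `f` and the integral of `g` has zero weak derivative, so it is a.e.
constant; continuity upgrades this to every point. -/
theorem HasWeakDeriv.isPrimitive {f g : ℝ → ℝ} (h : HasWeakDeriv f g) (hf : Continuous f) :
    IsPrimitive f g := by
  have hF := isPrimitive_intervalIntegral h.2.1 0
  set F : ℝ → ℝ := fun x => ∫ t in (0 : ℝ)..x, g t
  obtain ⟨c, hc⟩ := ae_const_of_integral_mul_deriv_eq_zero (w := fun x => f x - F x)
    (hf.sub hF.continuous).locallyIntegrable fun φ hφ hφc => by
      have h1 := h.2.2 φ hφ hφc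
      have h2 := hF.hasWeakDeriv.2.2 φ hφ hφc
      have hd : Continuous (deriv φ) := hφ.continuous_deriv (by simp)
      simp only [sub_mul]
      rw [integral_sub, h1, h2, sub_self]
      · exact (hf.mul hd).integrable_of_hasCompactSupport hφc.deriv.mul_left
      · exact (hF.continuous.mul hd).integrable_of_hasCompactSupport hφc.deriv.mul_left
  have hc' := ((hf.sub hF.continuous).ae_eq_iff_eq volume continuous_const).mp hc
  refine ⟨h.2.1, fun a b => ?_⟩
  rw [← hF.sub_eq]
  have ha := congrFun hc' a
  have hb := congrFun hc' b
  simp only [Pi.sub_apply] at ha hb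
  linarith

/-! ### Lipschitz functions, `W^{1,∞}` and `H¹` -/

theorem locallyIntegrable_deriv_of_lipschitzWith {f : ℝ → ℝ} {K : ℝ≥0} (hf : LipschitzWith K f) :
    LocallyIntegrable (deriv f) volume :=
  (locallyIntegrable_const (K : ℝ)).mono (measurable_deriv f).aestronglyMeasurable
    (ae_of_all _ fun x => by
      simpa using norm_deriv_le_of_lipschitz hf)

theorem _root_.LipschitzWith.isPrimitive {f : ℝ → ℝ} {K : ℝ≥0} (hf : LipschitzWith K f) :
    IsPrimitive f (deriv f) where
  locallyIntegrable := locallyIntegrable_deriv_of_lipschitzWith hf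
  sub_eq _ _ := (hf.lipschitzOnWith.absolutelyContinuousOnInterval.integral_deriv_eq_sub).symm

theorem _root_.LipschitzWith.weakDeriv_ae_eq {f : ℝ → ℝ} {K : ℝ≥0} (hf : LipschitzWith K f) :
    weakDeriv f =ᵐ[volume] deriv f :=
  hf.isPrimitive.weakDeriv_ae_eq

theorem _root_.MeasureTheory.MemLp.exists_ae_bound {f : ℝ → ℝ} (hf : MemLp f ∞ volume) :
    ∃ K : ℝ≥0, ∀ᵐ x, |f x| ≤ K := by
  have h := hf.eLpNorm_lt_top
  rw [eLpNorm_exponent_top] at h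
  refine ⟨(eLpNormEssSup f volume).toNNReal, ?_⟩
  filter_upwards [enorm_ae_le_eLpNormEssSup f volume] with x hx
  rw [← ENNReal.coe_toNNReal h.ne, enorm_le_coe] at hx
  simpa using NNReal.coe_le_coe.mpr hx

theorem IsPrimitive.lipschitzWith {f g : ℝ → ℝ} {K : ℝ≥0} (h : IsPrimitive f g)
    (hg : ∀ᵐ x, |g x| ≤ K) : LipschitzWith K f := by
  refine LipschitzWith.of_dist_le_mul fun b a => ?_
  rw [Real.dist_eq, Real.dist_eq, h.sub_eq]
  exact intervalIntegral.norm_integral_le_of_norm_le_const_ae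
    (hg.mono fun x hx _ => (Real.norm_eq_abs _).trans_le hx)

theorem forall_abs_le_of_ae {f : ℝ → ℝ} (hf : Continuous f) {C : ℝ} (h : ∀ᵐ x, |f x| ≤ C) (x : ℝ) :
    |f x| ≤ C := by
  have : IsClosed {x | |f x| ≤ C} := isClosed_le hf.abs continuous_const
  have hd : Dense {x | |f x| ≤ C} := Measure.dense_of_ae h
  have hu : {x | |f x| ≤ C} = univ := this.closure_eq.symm.trans hd.closure_eq
  exact hu.symm.subset (mem_univ x)

theorem memLp_top_of_forall_abs_le {f : ℝ → ℝ} (hf : AEStronglyMeasurable f volume) {C : ℝ}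
    (h : ∀ x, |f x| ≤ C) : MemLp f ∞ volume :=
  memLp_top_of_bound hf C (ae_of_all _ h)

/-- Among continuous functions, `W^{1,∞}` consists of the bounded Lipschitz functions. -/
theorem memW1Inf_iff {f : ℝ → ℝ} (hf : Continuous f) :
    MemW1Inf f ↔ (∃ C, ∀ x, |f x| ≤ C) ∧ ∃ K, LipschitzWith K f := by
  constructor
  · rintro ⟨hb, g, hg, hgb⟩
    obtain ⟨C, hC⟩ := hb.exists_ae_bound
    obtain ⟨K, hK⟩ := hgb.exists_ae_bound
    exact ⟨⟨C, forall_abs_le_of_ae hf hC⟩, K, (hg.isPrimitive hf).lipschitzWith hK⟩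
  · rintro ⟨⟨C, hC⟩, K, hK⟩
    exact ⟨memLp_top_of_forall_abs_le hf.aestronglyMeasurable hC, _, hK.isPrimitive.hasWeakDeriv,
      memLp_top_of_forall_abs_le (C := K) (measurable_deriv f).aestronglyMeasurable
        fun x => by simpa using norm_deriv_le_of_lipschitz hK⟩

/-- Cauchy-Schwarz inequality for a primitive of a square integrable function. -/
theorem IsPrimitive.sq_sub_le {f g : ℝ → ℝ} (h : IsPrimitive f g) (hg : MemLp g 2 volume) {a b : ℝ}
    (hab : a ≤ b) : (f b - f a) ^ 2 ≤ (b - a) * ∫ x in a..b, g x ^ 2 := by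
  rcases hab.eq_or_lt with rfl | hab
  · simp
  have hi : IntervalIntegrable (fun x => g x ^ 2) volume a b := hg.integrable_sq.intervalIntegrable
  -- `m` is the mean of `g` over the interval; the inequality says that the variance is nonnegative.
  set m := (f b - f a) / (b - a) with hm
  have h0 : 0 ≤ ∫ x in a..b, (g x - m) ^ 2 :=
    intervalIntegral.integral_nonneg hab.le fun x _ => sq_nonneg _
  have h1 : ∫ x in a..b, (g x - m) ^ 2 =
      (∫ x in a..b, g x ^ 2) - 2 * m * (f b - f a) + (b - a) * m ^ 2 := by
    have : ∀ x, (g x - m) ^ 2 = g x ^ 2 - 2 * m * g x + m ^ 2 := fun x => by ring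
    simp only [this]
    rw [intervalIntegral.integral_add (hi.sub ((h.intervalIntegrable a b).const_mul _)) (by simp),
      intervalIntegral.integral_sub hi ((h.intervalIntegrable a b).const_mul _),
      intervalIntegral.integral_const_mul, ← h.sub_eq]
    simp
  have hba : 0 < b - a := sub_pos.mpr hab
  have hmf : f b - f a = m * (b - a) := by rw [hm]; field_simp
  rw [h1, hmf] at h0
  rw [hmf]
  nlinarith

/-- Functions of `H¹(ℝ)` are bounded. -/
theorem exists_abs_le_of_memLp {v g : ℝ → ℝ} (h : IsPrimitive v g) (hv : MemLp v 2 volume)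
    (hg : MemLp g 2 volume) : ∃ C, ∀ x, |v x| ≤ C := by
  set A := ∫ x, v x ^ 2
  set B := ∫ x, g x ^ 2
  have hB : 0 ≤ B := integral_nonneg fun x => sq_nonneg _
  refine ⟨Real.sqrt (2 * A + 2 * B), fun x => Real.abs_le_sqrt ?_⟩
  have hle : ∀ (w : ℝ → ℝ), MemLp w 2 volume → ∀ a b, a ≤ b →
      ∫ t in a..b, w t ^ 2 ≤ ∫ t, w t ^ 2 := fun w hw a b hab => by
    rw [intervalIntegral.integral_of_le hab]
    exact setIntegral_le_integral hw.integrable_sq (ae_of_all _ fun t => sq_nonneg _)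
  -- On a window of length one the oscillation is controlled by `B`; integrating over `t` then
  -- bounds the value at `x`.
  have h1 : ∀ t ∈ Icc x (x + 1), v x ^ 2 ≤ 2 * v t ^ 2 + 2 * B := fun t ht => by
    have h2 := h.sq_sub_le hg ht.1
    have h3 := hle g hg x t ht.1
    have h4 : 0 ≤ ∫ s in x..t, g s ^ 2 :=
      intervalIntegral.integral_nonneg ht.1 fun s _ => sq_nonneg _
    have h5 : (v t - v x) ^ 2 ≤ B := by
      refine h2.trans (le_trans ?_ h3)
      nlinarith [ht.2]
    nlinarith [sq_nonneg (2 * v t - v x)]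
  have hi : IntervalIntegrable (fun t => 2 * v t ^ 2) volume x (x + 1) :=
    (hv.integrable_sq.const_mul 2).intervalIntegrable
  have h2 := intervalIntegral.integral_mono_on (by linarith : x ≤ x + 1)
    (intervalIntegrable_const (c := v x ^ 2)) (hi.add (intervalIntegrable_const (c := 2 * B))) h1
  rw [intervalIntegral.integral_add hi intervalIntegrable_const,
    intervalIntegral.integral_const_mul] at h2
  simp only [intervalIntegral.integral_const, add_sub_cancel_left, one_smul] at h2
  have h3 := hle v hv x (x + 1) (by linarith)
  linarith

/-! ### Partition functions and the space `H_{0,∞}` -/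

namespace IsPartitionFunction

variable {χ : ℝ → ℝ}

theorem mem_Icc (hχ : IsPartitionFunction χ) (x : ℝ) : χ x ∈ Icc (0 : ℝ) 1 := by
  have hm : Monotone χ := monotone_of_deriv_nonneg
    (hχ.contDiff.differentiable (by simp)) hχ.deriv_nonneg
  constructor
  · rw [← hχ.eq_zero (min x 0) (min_le_right _ _)]
    exact hm (min_le_left _ _)
  · rw [← hχ.eq_one (max x 1) (le_max_right _ _)]
    exact hm (le_max_left _ _)

theorem hasCompactSupport_deriv (hχ : IsPartitionFunction χ) : HasCompactSupport (deriv χ) := by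
  refine HasCompactSupport.intro (isCompact_Icc (a := (0 : ℝ)) (b := 1)) fun x hx => ?_
  rcases lt_or_ge x 0 with h | h
  · have : χ =ᶠ[𝓝 x] fun _ => 0 := by
      filter_upwards [Iio_mem_nhds h] with t ht using hχ.eq_zero t (le_of_lt ht)
    rw [this.deriv_eq, deriv_const]
  · have h1 : 1 < x := by
      by_contra hcon
      exact hx ⟨h, not_lt.mp hcon⟩
    have : χ =ᶠ[𝓝 x] fun _ => 1 := by
      filter_upwards [Ioi_mem_nhds h1] with t ht using hχ.eq_one t (le_of_lt ht)
    rw [this.deriv_eq, deriv_const]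

theorem memLp_deriv (hχ : IsPartitionFunction χ) : MemLp (deriv χ) 2 volume :=
  (hχ.contDiff.continuous_deriv (by simp)).memLp_of_hasCompactSupport hχ.hasCompactSupport_deriv

theorem isPrimitive (hχ : IsPartitionFunction χ) : IsPrimitive χ (deriv χ) where
  locallyIntegrable := (hχ.contDiff.continuous_deriv (by simp)).locallyIntegrable
  sub_eq a b := (intervalIntegral.integral_deriv_eq_sub
    (fun x _ => hχ.contDiff.differentiable (by simp) x)
    ((hχ.contDiff.continuous_deriv (by simp)).intervalIntegrable _ _)).symm

/-- The composition of a partition function with a bounded perturbation of the identity differs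
from it by a function of `L²(ℝ)`. -/
theorem memLp_sub_comp (hχ : IsPartitionFunction χ) {y : ℝ → ℝ} (hy : Continuous y) {C : ℝ}
    (hC : ∀ x, |y x - x| ≤ C) : MemLp (fun x => χ x - χ (y x)) 2 volume := by
  have hc := hχ.contDiff.continuous
  refine (hc.sub (hc.comp hy)).memLp_of_hasCompactSupport ?_
  refine HasCompactSupport.intro (isCompact_Icc (a := -C) (b := 1 + C)) fun x hx => ?_
  have h1 := abs_le.mp (hC x)
  have hC0 : 0 ≤ C := (abs_nonneg _).trans (hC x)
  change χ x - χ (y x) = 0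
  rcases lt_or_ge x (-C) with h | h
  · rw [hχ.eq_zero x (by linarith), hχ.eq_zero (y x) (by linarith), sub_zero]
  · have h2 : 1 + C < x := by
      by_contra hcon
      exact hx ⟨h, not_lt.mp hcon⟩
    rw [hχ.eq_one x (by linarith), hχ.eq_one (y x) (by linarith), sub_self]

theorem memH0Inf_iff (hχ : IsPartitionFunction χ) {u : ℝ → ℝ} :
    MemH0Inf χ u ↔ (∃ c, MemLp (fun x => u x - c * χ x) 2 volume) ∧
      ∃ g, IsPrimitive u g ∧ MemLp g 2 volume := by
  constructor
  · rintro ⟨v, c, ⟨hvc, hv, g, hg, hg2⟩, hu⟩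
    obtain rfl : u = fun x => v x + c * χ x := funext hu
    refine ⟨⟨c, by simpa using hv⟩, _, (hg.isPrimitive hvc).add (hχ.isPrimitive.const_mul c), ?_⟩
    exact hg2.add (hχ.memLp_deriv.const_mul c)
  · rintro ⟨⟨c, hc⟩, g, hg, hg2⟩
    have hp := hg.sub (hχ.isPrimitive.const_mul c)
    exact ⟨_, c, ⟨hp.continuous, hc, _, hp.hasWeakDeriv, hg2.sub (hχ.memLp_deriv.const_mul c)⟩,
      fun x => by ring⟩

theorem exists_abs_le (hχ : IsPartitionFunction χ) {u : ℝ → ℝ} (hu : MemH0Inf χ u) :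
    ∃ C, ∀ x, |u x| ≤ C := by
  obtain ⟨v, c, ⟨hvc, hv, g, hg, hg2⟩, hu⟩ := hu
  obtain ⟨C, hC⟩ := exists_abs_le_of_memLp (hg.isPrimitive hvc) hv hg2
  refine ⟨C + |c|, fun x => ?_⟩
  rw [hu]
  refine (abs_add_le _ _).trans (add_le_add (hC x) ?_)
  rw [abs_mul]
  have := hχ.mem_Icc x
  rw [abs_of_nonneg this.1]
  exact mul_le_of_le_one_right (abs_nonneg _) this.2

end IsPartitionFunction

/-! ### Change of variables along monotone Lipschitz maps -/

section ChangeOfVariables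

variable {y : ℝ → ℝ} {K : ℝ≥0}

theorem volume_image_eq_zero (hL : LipschitzWith K y) {N : Set ℝ} (hN : volume N = 0) :
    volume (y '' N) = 0 := by
  have h := hL.lipschitzOnWith (s := N) |>.hausdorffMeasure_image_le (d := 1) zero_le_one
  rw [hausdorffMeasure_real, hN, mul_zero] at h
  exact le_antisymm h zero_le

/-- By Rademacher the discarded points form a null set, and Lipschitz maps send null sets to null
sets. -/
theorem image_inter_differentiableAt_ae_eq (hL : LipschitzWith K y) (A : Set ℝ) :
    (y '' (A ∩ {ξ | DifferentiableAt ℝ y ξ}) : Set ℝ) =ᵐ[volume] y '' A := by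
  refine (ae_eq_set).mpr ⟨?_, ?_⟩
  · rw [sdiff_eq_empty.mpr (image_mono inter_subset_left), measure_empty]
  · refine measure_mono_null ?_ (volume_image_eq_zero hL (N := {ξ | ¬ DifferentiableAt ℝ y ξ})
      (ae_iff.mp hL.ae_differentiableAt_real))
    rintro _ ⟨⟨ξ, hξ, rfl⟩, hn⟩
    exact ⟨ξ, fun hd => hn ⟨ξ, ⟨hξ, hd⟩, rfl⟩, rfl⟩

theorem inter_differentiableAt_ae_eq (hL : LipschitzWith K y) (A : Set ℝ) :
    (A ∩ {ξ | DifferentiableAt ℝ y ξ} : Set ℝ) =ᵐ[volume] A :=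
  inter_ae_eq_left_of_ae_eq_univ (eventuallyEq_univ.mpr hL.ae_differentiableAt_real)

/-- Change of variables for a monotone Lipschitz function. -/
theorem lintegral_image_eq (hL : LipschitzWith K y) (hm : Monotone y) {A : Set ℝ}
    (hA : MeasurableSet A) (φ : ℝ → ℝ≥0∞) :
    ∫⁻ x in y '' A, φ x = ∫⁻ ξ in A, ENNReal.ofReal (deriv y ξ) * φ (y ξ) := by
  rw [← setLIntegral_congr (image_inter_differentiableAt_ae_eq hL A),
    lintegral_image_eq_lintegral_deriv_mul_of_monotoneOn
      (hA.inter (measurableSet_of_differentiableAt ℝ y))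
      (fun ξ hξ => hξ.2.hasDerivAt.hasDerivWithinAt) (hm.monotoneOn _),
    setLIntegral_congr (inter_differentiableAt_ae_eq hL A)]

theorem integral_image_eq (hL : LipschitzWith K y) (hm : Monotone y) {A : Set ℝ}
    (hA : MeasurableSet A) (g : ℝ → ℝ) :
    ∫ x in y '' A, g x = ∫ ξ in A, deriv y ξ * g (y ξ) := by
  rw [← setIntegral_congr_set (image_inter_differentiableAt_ae_eq hL A),
    integral_image_eq_integral_deriv_smul_of_monotoneOn
      (hA.inter (measurableSet_of_differentiableAt ℝ y))
      (fun ξ hξ => hξ.2.hasDerivAt.hasDerivWithinAt) (hm.monotoneOn _),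
    setIntegral_congr_set (inter_differentiableAt_ae_eq hL A)]
  rfl

theorem integral_comp_mul_deriv (hL : LipschitzWith K y) (hm : Monotone y) {α β : ℝ}
    (hαβ : α ≤ β) (g : ℝ → ℝ) :
    ∫ x in y α..y β, g x = ∫ ξ in α..β, deriv y ξ * g (y ξ) := by
  rw [intervalIntegral.integral_of_le (hm hαβ), intervalIntegral.integral_of_le hαβ,
    ← integral_Icc_eq_integral_Ioc, ← integral_Icc_eq_integral_Ioc,
    ← integral_image_eq hL hm measurableSet_Icc]
  congr 2
  exact (Subset.antisymm ((hm.monotoneOn _).image_Icc_subset)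
    (intermediate_value_Icc hαβ hL.continuous.continuousOn)).symm

theorem map_withDensity_deriv_mul_comp (hL : LipschitzWith K y) (hm : Monotone y)
    (hs : Function.Surjective y) (φ : ℝ → ℝ≥0∞) :
    (volume.withDensity fun ξ => ENNReal.ofReal (deriv y ξ) * φ (y ξ)).map y =
      volume.withDensity φ := by
  ext B hB
  have hB' := hL.continuous.measurable hB
  rw [Measure.map_apply hL.continuous.measurable hB, withDensity_apply _ hB',
    withDensity_apply _ hB, ← lintegral_image_eq hL hm hB', image_preimage_eq _ hs]

theorem map_withDensity_deriv (hL : LipschitzWith K y) (hm : Monotone y)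
    (hs : Function.Surjective y) :
    (volume.withDensity fun ξ => ENNReal.ofReal (deriv y ξ)).map y = volume := by
  simpa using map_withDensity_deriv_mul_comp hL hm hs 1

theorem lintegral_eq_lintegral_comp (hL : LipschitzWith K y) (hm : Monotone y)
    (hs : Function.Surjective y) (φ : ℝ → ℝ≥0∞) :
    ∫⁻ x, φ x = ∫⁻ ξ, ENNReal.ofReal (deriv y ξ) * φ (y ξ) := by
  have := lintegral_image_eq hL hm MeasurableSet.univ φ
  simpa [hs.range_eq] using this

/-- The integral of `y'` over the preimage of a null set equals the measure of its image, which is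
zero, while `y' ≥ 0`. This lets a.e. statements in `x` be used at `y ξ` wherever `y' ≠ 0`. -/
theorem ae_deriv_eq_zero_of_mem_null (hL : LipschitzWith K y) (hm : Monotone y) {N : Set ℝ}
    (hN : volume N = 0) : ∀ᵐ ξ, y ξ ∈ N → deriv y ξ = 0 := by
  have hM := measurableSet_toMeasurable volume N
  have hA := hL.continuous.measurable hM
  have h := lintegral_image_eq hL hm hA 1
  have h0 : volume (y '' (y ⁻¹' toMeasurable volume N)) = 0 :=
    measure_mono_null (image_preimage_subset _ _) ((measure_toMeasurable N).trans hN)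
  simp only [Pi.one_apply, mul_one, lintegral_one, Measure.restrict_apply MeasurableSet.univ,
    univ_inter, h0] at h
  rw [eq_comm, lintegral_eq_zero_iff (by fun_prop), EventuallyEq, ae_restrict_iff' hA] at h
  filter_upwards [h] with ξ hξ hmem
  have := hξ (subset_toMeasurable _ _ hmem)
  exact le_antisymm (by simpa using this) (hm.deriv_nonneg)

theorem volume_image_deriv_eq_zero (hL : LipschitzWith K y) (hm : Monotone y) :
    volume (y '' {ξ | deriv y ξ = 0}) = 0 := by
  have hA : MeasurableSet {ξ | deriv y ξ = 0} := measurable_deriv y (measurableSet_singleton 0)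
  have h := lintegral_image_eq hL hm hA 1
  simp only [Pi.one_apply, mul_one, lintegral_one, Measure.restrict_apply MeasurableSet.univ,
    univ_inter] at h
  rw [h, setLIntegral_congr_fun hA (g := fun _ => 0) fun ξ hξ => by simp [show deriv y ξ = 0 from hξ]]
  simp

/-- Monotonicity makes `y` constant between the two points, so a one-sided derivative vanishes;
without differentiability, `deriv` is `0` by convention. -/
theorem deriv_eq_zero_of_apply_eq (hm : Monotone y) {ξ η : ℝ} (hne : η ≠ ξ) (h : y η = y ξ) :
    deriv y ξ = 0 := by
  by_cases hd : DifferentiableAt ℝ y ξ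
  swap
  · exact deriv_zero_of_not_differentiableAt hd
  have hu : UniqueDiffWithinAt ℝ (uIcc η ξ) ξ :=
    uniqueDiffOn_Icc (min_lt_max.mpr hne) ξ right_mem_uIcc
  have hc : ∀ t ∈ uIcc η ξ, y t = y ξ := fun t ht => by
    have h1 := hm.monotoneOn (uIcc η ξ) |>.mapsTo_uIcc ht
    rw [h, uIcc_self] at h1
    exact h1
  have h1 := hd.hasDerivAt.hasDerivWithinAt (s := uIcc η ξ)
  have h2 : HasDerivWithinAt y 0 (uIcc η ξ) ξ :=
    (hasDerivWithinAt_const ξ _ (y ξ)).congr hc rfl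
  exact hu.eq_deriv _ h1 h2

theorem monotone_of_rightInverse (hm : Monotone y) {s : ℝ → ℝ} (hs : Function.RightInverse s y) :
    Monotone s := by
  intro a b hab
  rcases hab.eq_or_lt with rfl | hab
  · rfl
  by_contra hcon
  have := hm (not_le.mp hcon).le
  rw [hs a, hs b] at this
  linarith

theorem surjective_of_abs_sub_le (hy : Continuous y) {C : ℝ} (hC : ∀ x, |y x - x| ≤ C) :
    Function.Surjective y := fun x => by
  have h1 := abs_le.mp (hC (x - C))
  have h2 := abs_le.mp (hC (x + C))
  exact mem_range_of_exists_le_of_exists_ge hy ⟨x - C, by linarith⟩ ⟨x + C, by linarith⟩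

theorem IsPrimitive.monotone {f g : ℝ → ℝ} (h : IsPrimitive f g) (hg : ∀ᵐ x, 0 ≤ g x) :
    Monotone f := fun a b hab => by
  rw [← sub_nonneg, h.sub_eq]
  exact intervalIntegral.integral_nonneg_of_ae hab hg

end ChangeOfVariables

/-! ### The relabeling group and its action -/

section Relabeling

theorem lipschitzWith_of_sub_id {f : ℝ → ℝ} (h : ∃ K, LipschitzWith K fun ξ => f ξ - ξ) :
    ∃ K, LipschitzWith K f := by
  obtain ⟨K, hK⟩ := h
  exact ⟨K + 1, by simpa using hK.add LipschitzWith.id⟩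

theorem sub_id_of_lipschitzWith {f : ℝ → ℝ} (h : ∃ K, LipschitzWith K f) :
    ∃ K, LipschitzWith K fun ξ => f ξ - ξ := by
  obtain ⟨K, hK⟩ := h
  exact ⟨K + 1, hK.sub LipschitzWith.id⟩

theorem memW1Inf_sub_id_iff {f : ℝ → ℝ} (hf : Continuous f) :
    MemW1Inf (fun ξ => f ξ - ξ) ↔ (∃ C, ∀ x, |f x - x| ≤ C) ∧ ∃ K, LipschitzWith K f := by
  rw [memW1Inf_iff (f := fun ξ => f ξ - ξ) (hf.sub continuous_id)]
  exact and_congr_right fun _ => ⟨lipschitzWith_of_sub_id, sub_id_of_lipschitzWith⟩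

theorem isRelabeling_iff {f : ℝ ≃ₜ ℝ} :
    IsRelabeling f ↔ (∃ C, ∀ x, |f x - x| ≤ C) ∧ (∃ K, LipschitzWith K f) ∧
      (∃ K, LipschitzWith K f.symm) ∧ MemLp (fun ξ => deriv f ξ - 1) 2 volume := by
  have key : ∀ K, LipschitzWith K f → (MemLp (fun ξ => weakDeriv f ξ - 1) 2 volume ↔
      MemLp (fun ξ => deriv f ξ - 1) 2 volume) := fun K hK =>
    memLp_congr_ae (hK.weakDeriv_ae_eq.mono fun x hx => by simp only [hx])
  constructor
  · rintro ⟨h1, h2, h3⟩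
    obtain ⟨hC, K, hK⟩ := (memW1Inf_sub_id_iff f.continuous).mp h1
    exact ⟨hC, ⟨K, hK⟩, ((memW1Inf_sub_id_iff f.symm.continuous).mp h2).2, (key K hK).mp h3⟩
  · rintro ⟨⟨C, hC⟩, ⟨K, hK⟩, h2, h3⟩
    refine ⟨(memW1Inf_sub_id_iff f.continuous).mpr ⟨⟨C, hC⟩, K, hK⟩,
      (memW1Inf_sub_id_iff f.symm.continuous).mpr ⟨⟨C, fun x => ?_⟩, h2⟩, (key K hK).mpr h3⟩
    have := hC (f.symm x)
    rwa [f.apply_symm_apply, abs_sub_comm] at this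

namespace IsRelabeling

variable {f g : ℝ ≃ₜ ℝ}

theorem exists_abs_sub_le (hf : IsRelabeling f) : ∃ C, ∀ x, |f x - x| ≤ C :=
  (isRelabeling_iff.mp hf).1

theorem exists_lipschitzWith (hf : IsRelabeling f) : ∃ K, LipschitzWith K f :=
  (isRelabeling_iff.mp hf).2.1

theorem exists_lipschitzWith_symm (hf : IsRelabeling f) : ∃ K, LipschitzWith K f.symm :=
  (isRelabeling_iff.mp hf).2.2.1

theorem memLp_deriv_sub_one (hf : IsRelabeling f) : MemLp (fun ξ => deriv f ξ - 1) 2 volume :=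
  (isRelabeling_iff.mp hf).2.2.2

/-- A continuous injection is strictly monotone, and a decreasing one cannot stay within bounded
distance of the identity. -/
theorem strictMono (hf : IsRelabeling f) : StrictMono f := by
  rcases f.continuous.strictMono_of_inj f.injective with h | h
  · exact h
  · obtain ⟨C, hC⟩ := hf.exists_abs_sub_le
    have h0 := abs_le.mp (hC 0)
    have hC0 : 0 ≤ C := (abs_nonneg _).trans (hC 0)
    have h1 := abs_le.mp (hC (2 * C + 1))
    have h2 := h (show (0 : ℝ) < 2 * C + 1 by linarith)
    linarith

theorem preimage_null (hf : IsRelabeling f) {N : Set ℝ} (hN : volume N = 0) :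
    volume (f ⁻¹' N) = 0 := by
  obtain ⟨K, hK⟩ := hf.exists_lipschitzWith_symm
  rw [← f.image_symm]
  exact volume_image_eq_zero hK hN

theorem ae_comp (hf : IsRelabeling f) {p : ℝ → Prop} (hp : ∀ᵐ x, p x) : ∀ᵐ x, p (f x) :=
  hf.preimage_null hp

theorem symm_ae_comp (hf : IsRelabeling f) {p : ℝ → Prop} (hp : ∀ᵐ x, p x) :
    ∀ᵐ x, p (f.symm x) := by
  obtain ⟨K, hK⟩ := hf.exists_lipschitzWith
  have : volume (f '' {x | ¬ p x}) = 0 := volume_image_eq_zero hK hp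
  rw [← f.symm_symm, f.symm.image_symm] at this
  exact this

/-- The chain rule fails only on null sets because `f` pulls null sets back to null sets, its
inverse being Lipschitz. -/
theorem ae_deriv_comp (hf : IsRelabeling f) {v : ℝ → ℝ} {K : ℝ≥0} (hv : LipschitzWith K v) :
    ∀ᵐ x, deriv (fun ξ => v (f ξ)) x = deriv v (f x) * deriv f x := by
  obtain ⟨K', hK'⟩ := hf.exists_lipschitzWith
  filter_upwards [hf.ae_comp hv.ae_differentiableAt_real, hK'.ae_differentiableAt_real]
    with x hx hx'
  exact (hx.hasDerivAt.comp x hx'.hasDerivAt).deriv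

theorem ae_deriv_symm_mul_deriv (hf : IsRelabeling f) :
    ∀ᵐ x, deriv f.symm (f x) * deriv f x = 1 := by
  obtain ⟨K, hK⟩ := hf.exists_lipschitzWith_symm
  filter_upwards [hf.ae_deriv_comp hK] with x hx
  rw [← hx]
  simp

theorem deriv_nonneg (hf : IsRelabeling f) (x : ℝ) : 0 ≤ deriv f x :=
  hf.strictMono.monotone.deriv_nonneg

theorem _root_.LipschitzWith.memLp_comp_of_symm {K : ℝ≥0} (hK : LipschitzWith K f.symm)
    {φ : ℝ → ℝ} (hφ : MemLp φ 2 volume) : MemLp (fun x => φ (f x)) 2 volume := by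
  have hle : (volume : Measure ℝ).map f ≤ (K : ℝ≥0∞) • volume := by
    refine Measure.le_iff.mpr fun B hB => ?_
    rw [Measure.map_apply f.continuous.measurable hB, ← f.image_symm]
    have h := hK.lipschitzOnWith (s := B) |>.hausdorffMeasure_image_le (d := 1) zero_le_one
    rw [hausdorffMeasure_real] at h
    simpa using h
  exact (hφ.of_measure_le_smul ENNReal.coe_ne_top hle).comp_of_map
    f.continuous.measurable.aemeasurable

theorem _root_.MeasureTheory.MemLp.mul_deriv_of_lipschitzWith {φ v : ℝ → ℝ} {K : ℝ≥0}
    (hφ : MemLp φ 2 volume) (hv : LipschitzWith K v) :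
    MemLp (fun x => φ x * deriv v x) 2 volume := by
  refine hφ.of_le_mul (c := K) (hφ.aestronglyMeasurable.mul
    (measurable_deriv v).aestronglyMeasurable) (ae_of_all _ fun x => ?_)
  rw [norm_mul, mul_comm]
  exact mul_le_mul_of_nonneg_right (norm_deriv_le_of_lipschitz hv) (norm_nonneg _)

protected theorem refl : IsRelabeling (Homeomorph.refl ℝ) := by
  refine isRelabeling_iff.mpr ⟨⟨0, by simp⟩, ⟨1, LipschitzWith.id⟩, ⟨1, LipschitzWith.id⟩, ?_⟩
  have : (fun ξ => deriv (Homeomorph.refl ℝ) ξ - 1) = fun _ => (0 : ℝ) := by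
    funext ξ
    change deriv id ξ - 1 = 0
    simp
  rw [this]
  exact MemLp.zero'

protected theorem symm (hf : IsRelabeling f) : IsRelabeling f.symm := by
  obtain ⟨K, hK⟩ := hf.exists_lipschitzWith
  obtain ⟨K', hK'⟩ := hf.exists_lipschitzWith_symm
  obtain ⟨C, hC⟩ := hf.exists_abs_sub_le
  refine isRelabeling_iff.mpr ⟨⟨C, fun x => ?_⟩, ⟨K', hK'⟩, ⟨K, by simpa using hK⟩, ?_⟩
  · have := hC (f.symm x)
    rwa [f.apply_symm_apply, abs_sub_comm] at this
  -- Uses `(f⁻¹)' - 1 = (1 - f' ∘ f⁻¹) (f⁻¹)'`, with a bounded second factor.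
  · have h1 : MemLp (fun x => 1 - deriv f (f.symm x)) 2 volume := by
      have := (LipschitzWith.memLp_comp_of_symm (f := f.symm) (by simpa using hK)
        hf.memLp_deriv_sub_one).neg
      exact (memLp_congr_ae (ae_of_all _ fun x => by simp)).mp this
    refine (memLp_congr_ae ?_).mp (h1.mul_deriv_of_lipschitzWith hK')
    filter_upwards [hf.symm_ae_comp hf.ae_deriv_symm_mul_deriv] with x hx
    rw [f.apply_symm_apply] at hx
    linarith

protected theorem trans (hf : IsRelabeling f) (hg : IsRelabeling g) : IsRelabeling (f.trans g) := by
  obtain ⟨K, hK⟩ := hf.exists_lipschitzWith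
  obtain ⟨K', hK'⟩ := hf.exists_lipschitzWith_symm
  obtain ⟨C, hC⟩ := hf.exists_abs_sub_le
  obtain ⟨L, hL⟩ := hg.exists_lipschitzWith
  obtain ⟨L', hL'⟩ := hg.exists_lipschitzWith_symm
  obtain ⟨D, hD⟩ := hg.exists_abs_sub_le
  refine isRelabeling_iff.mpr ⟨⟨D + C, fun x => ?_⟩, ⟨L * K, hL.comp hK⟩,
    ⟨K' * L', hK'.comp hL'⟩, ?_⟩
  · exact (abs_sub_le _ (f x) _).trans (add_le_add (hD _) (hC _))
  -- Uses `(g ∘ f)' - 1 = (g' ∘ f - 1) f' + (f' - 1)`.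
  · have h1 := (hK'.memLp_comp_of_symm hg.memLp_deriv_sub_one).mul_deriv_of_lipschitzWith hK
    refine (memLp_congr_ae ?_).mp (h1.add hf.memLp_deriv_sub_one)
    filter_upwards [hf.ae_deriv_comp hL] with x hx
    have : deriv (f.trans g) x = deriv g (f x) * deriv f x := hx
    simp only [Pi.add_apply, this]
    ring

end IsRelabeling

theorem relabeled_iff {χ : ℝ → ℝ} {X X' : Lagrangian χ} : Relabeled χ X X' ↔
    ∃ f : ℝ ≃ₜ ℝ, IsRelabeling f ∧ (∀ ξ, X'.1.y ξ = X.1.y (f ξ)) ∧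
      (∀ ξ, X'.1.U ξ = X.1.U (f ξ)) ∧ ∀ᵐ ξ, X'.1.h ξ = X.1.h (f ξ) * deriv f ξ := by
  refine exists_congr fun f => and_congr_right fun hf => and_congr_right fun _ =>
    and_congr_right fun _ => ?_
  obtain ⟨K, hK⟩ := hf.exists_lipschitzWith
  exact eventually_congr (hK.weakDeriv_ae_eq.mono fun x hx => by rw [hx])

theorem equivalence_relabeled (χ : ℝ → ℝ) : Equivalence (Relabeled χ) where
  refl X := relabeled_iff.mpr ⟨Homeomorph.refl ℝ, .refl, fun _ => rfl, fun _ => rfl,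
    ae_of_all _ fun ξ => by
      change X.1.h ξ = X.1.h ξ * deriv id ξ
      simp⟩
  symm {X X'} h := by
    obtain ⟨f, hf, hy, hU, hh⟩ := relabeled_iff.mp h
    refine relabeled_iff.mpr ⟨f.symm, hf.symm, fun ξ => by simp [hy], fun ξ => by simp [hU], ?_⟩
    filter_upwards [hf.symm_ae_comp hh, hf.symm_ae_comp hf.ae_deriv_symm_mul_deriv] with ξ h1 h2
    rw [f.apply_symm_apply] at h1 h2
    rw [h1, mul_assoc, mul_comm (deriv f _), h2, mul_one]
  trans {X X' X''} h h' := by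
    obtain ⟨f, hf, hy, hU, hh⟩ := relabeled_iff.mp h
    obtain ⟨g, hg, hy', hU', hh'⟩ := relabeled_iff.mp h'
    obtain ⟨K, hK⟩ := hf.exists_lipschitzWith
    refine relabeled_iff.mpr ⟨g.trans f, hg.trans hf, fun ξ => by simp [hy', hy],
      fun ξ => by simp [hU', hU], ?_⟩
    filter_upwards [hh', hg.ae_comp hh, hg.ae_deriv_comp hK] with ξ h1 h2 h3
    have h4 : deriv (g.trans f) ξ = deriv f (g ξ) * deriv g ξ := h3
    rw [h1, h2, h4, Homeomorph.trans_apply, mul_assoc]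

end Relabeling

/-! ### Regularity of Lagrangian triples and total energy -/

theorem MemH0Inf.continuous {χ u : ℝ → ℝ} (hχ : IsPartitionFunction χ) (hu : MemH0Inf χ u) :
    Continuous u := by
  obtain ⟨-, g, hg, -⟩ := hχ.memH0Inf_iff.mp hu
  exact hg.continuous

theorem MemH0Inf.memLp_deriv {χ u : ℝ → ℝ} (hχ : IsPartitionFunction χ) (hu : MemH0Inf χ u) :
    MemLp (deriv u) 2 volume := by
  obtain ⟨-, g, hg, hg2⟩ := hχ.memH0Inf_iff.mp hu
  exact (memLp_congr_ae hg.deriv_ae_eq).mpr hg2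

namespace MemCalG

variable {χ : ℝ → ℝ} {X : Triple}

theorem continuous_y (hX : MemCalG χ X) : Continuous X.y :=
  (hX.zeta_mem.1.add continuous_id).congr fun _ => sub_add_cancel _ _

theorem exists_abs_sub_le (hX : MemCalG χ X) : ∃ C, ∀ x, |X.y x - x| ≤ C :=
  ((memW1Inf_sub_id_iff hX.continuous_y).mp hX.zeta_W1Inf).1

theorem exists_lipschitzWith_y (hX : MemCalG χ X) : ∃ K, LipschitzWith K X.y :=
  ((memW1Inf_sub_id_iff hX.continuous_y).mp hX.zeta_W1Inf).2

theorem exists_lipschitzWith_U (hX : MemCalG χ X) (hχ : IsPartitionFunction χ) :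
    ∃ K, LipschitzWith K X.U :=
  ((memW1Inf_iff (hX.U_mem.continuous hχ)).mp hX.U_W1Inf).2

theorem monotone_y (hX : MemCalG χ X) : Monotone X.y := by
  obtain ⟨K, hK⟩ := hX.exists_lipschitzWith_y
  refine hK.isPrimitive.monotone ?_
  filter_upwards [hX.y_deriv_nonneg, hK.weakDeriv_ae_eq] with x h1 h2
  rwa [h2] at h1

theorem surjective_y (hX : MemCalG χ X) : Function.Surjective X.y := by
  obtain ⟨C, hC⟩ := hX.exists_abs_sub_le
  exact surjective_of_abs_sub_le hX.continuous_y hC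

theorem energy_deriv (hX : MemCalG χ X) (hχ : IsPartitionFunction χ) :
    ∀ᵐ ξ, deriv X.y ξ * X.h ξ = deriv X.U ξ ^ 2 := by
  obtain ⟨K, hK⟩ := hX.exists_lipschitzWith_y
  obtain ⟨L, hL⟩ := hX.exists_lipschitzWith_U hχ
  filter_upwards [hX.energy, hK.weakDeriv_ae_eq, hL.weakDeriv_ae_eq] with x h1 h2 h3
  rwa [h2, h3] at h1

theorem locallyIntegrable_h (hX : MemCalG χ X) : LocallyIntegrable X.h volume :=
  hX.h_mem.locallyIntegrable (by norm_num)

theorem integrableOn_Iic (hX : MemCalG χ X) {a : ℝ} (ha : IntegrableOn X.h (Iic a)) (b : ℝ) :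
    IntegrableOn X.h (Iic b) := by
  refine (ha.union (hX.locallyIntegrable_h.integrableOn_isCompact
    (isCompact_Icc (a := a) (b := b)))).mono_set fun x hx => ?_
  rcases le_total x a with h | h
  · exact Or.inl h
  · exact Or.inr ⟨h, hx⟩

end MemCalG

namespace MemF

variable {χ : ℝ → ℝ} {X : Triple}

/-- The energy density of an element of `ℱ` is integrable: otherwise `H` would vanish by
convention, and `y` would be a relabeling. -/
theorem integrable_h (hX : MemF χ X) (hχ : IsPartitionFunction χ) : Integrable X.h volume := by
  obtain ⟨hG, f, hf, hfy⟩ := hX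
  by_cases hI : IntegrableOn X.h (Iic 0)
  · obtain ⟨C, hC⟩ := hf.exists_abs_sub_le
    obtain ⟨D, hD⟩ := hG.exists_abs_sub_le
    have hH : ∀ ξ, |∫ t in Iic ξ, X.h t| ≤ C + D := fun ξ => by
      have h1 : ∫ t in Iic ξ, X.h t = (f ξ - ξ) - (X.y ξ - ξ) := by rw [hfy]; ring
      rw [h1]
      exact (abs_sub _ _).trans (add_le_add (hC ξ) (hD ξ))
    refine integrable_of_intervalIntegral_norm_bounded (l := atTop) (a := fun n : ℕ => -(n : ℝ))
      (b := fun n : ℕ => (n : ℝ)) (2 * (C + D)) (fun n => ?_)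
      (tendsto_neg_atTop_atBot.comp tendsto_natCast_atTop_atTop) tendsto_natCast_atTop_atTop
      (Eventually.of_forall fun n => ?_)
    · exact (hG.integrableOn_Iic hI n).mono_set Ioc_subset_Iic_self
    · rw [intervalIntegral.integral_congr_ae (g := X.h) (hG.h_nonneg.mono fun x hx _ => by
        rw [Real.norm_of_nonneg hx]),
        ← intervalIntegral.integral_Iic_sub_Iic (hG.integrableOn_Iic hI _)
          (hG.integrableOn_Iic hI _)]
      have h1 := abs_le.mp (hH n)
      have h2 := abs_le.mp (hH (-n))
      linarith
  -- With `H = 0` by convention, `y = f` has a `K`-Lipschitz inverse, so `h ≤ K y_ξ h = K U_ξ²`,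
  -- which is integrable.
  · have hy : ∀ ξ, f ξ = X.y ξ := fun ξ => by
      rw [hfy, integral_undef fun h => hI (hG.integrableOn_Iic h 0), add_zero]
    obtain ⟨K, hK⟩ := hf.exists_lipschitzWith_symm
    refine (((hG.U_mem.memLp_deriv hχ).integrable_sq).const_mul (K : ℝ)).mono'
      hG.h_mem.aestronglyMeasurable ?_
    filter_upwards [hf.ae_deriv_symm_mul_deriv, hG.energy_deriv hχ, hG.h_nonneg] with x h1 h2 h3
    rw [show (f : ℝ → ℝ) = X.y from funext hy] at h1
    have h4 : deriv f.symm (X.y x) ≤ K :=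
      (le_abs_self _).trans (norm_deriv_le_of_lipschitz hK)
    have h5 := hG.monotone_y.deriv_nonneg (x := x)
    rw [Real.norm_of_nonneg h3, ← h2, ← mul_assoc]
    refine le_mul_of_one_le_left h3 ?_
    rw [← h1]
    exact mul_le_mul_of_nonneg_right h4 h5

end MemF

theorem memLp_two_iff_lintegral {φ : ℝ → ℝ} (hφ : AEStronglyMeasurable φ volume) :
    MemLp φ 2 volume ↔ ∫⁻ x, ENNReal.ofReal (φ x ^ 2) < ⊤ := by
  rw [memLp_two_iff_integrable_sq hφ, Integrable, hasFiniteIntegral_iff_ofReal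
    (ae_of_all _ fun x => sq_nonneg _)]
  exact and_iff_right (hφ.pow 2)

theorem memLp_of_memLp_comp {y φ : ℝ → ℝ} {K : ℝ≥0} (hL : LipschitzWith K y) (hm : Monotone y)
    (hs : Function.Surjective y) (hφ : AEStronglyMeasurable φ volume)
    (h : MemLp (fun ξ => φ (y ξ)) 2 volume) : MemLp φ 2 volume := by
  rw [memLp_two_iff_lintegral hφ, lintegral_eq_lintegral_comp hL hm hs]
  rw [memLp_two_iff_lintegral h.aestronglyMeasurable] at h
  calc ∫⁻ ξ, ENNReal.ofReal (deriv y ξ) * ENNReal.ofReal (φ (y ξ) ^ 2)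
      ≤ ∫⁻ ξ, (K : ℝ≥0∞) * ENNReal.ofReal (φ (y ξ) ^ 2) := by
        refine lintegral_mono fun ξ => mul_le_mul_left ?_ _
        rw [← ENNReal.ofReal_coe_nnreal]
        exact ENNReal.ofReal_le_ofReal ((le_abs_self _).trans (norm_deriv_le_of_lipschitz hL))
    _ = (K : ℝ≥0∞) * ∫⁻ ξ, ENNReal.ofReal (φ (y ξ) ^ 2) :=
        lintegral_const_mul' _ _ ENNReal.coe_ne_top
    _ < ⊤ := ENNReal.mul_lt_top ENNReal.coe_lt_top h

/-! ### From Lagrangian to Eulerian coordinates -/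

namespace Triple

/-- The velocity `u` with `u ∘ y = U`. -/
def eulerVelocity (X : Triple) (x : ℝ) : ℝ := X.U (Function.invFun X.y x)

/-- The energy measure `y_# (h dξ)`. -/
def eulerMeasure (X : Triple) : Measure ℝ :=
  (volume.withDensity fun ξ => ENNReal.ofReal (X.h ξ)).map X.y

/-- The derivative of the velocity, `U_ξ / y_ξ` in Eulerian coordinates. -/
def eulerSlope (X : Triple) (x : ℝ) : ℝ :=
  deriv X.U (Function.invFun X.y x) / deriv X.y (Function.invFun X.y x)

end Triple

namespace MemCalG

variable {χ : ℝ → ℝ} {X : Triple}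

theorem rightInverse_invFun (hX : MemCalG χ X) : Function.RightInverse (Function.invFun X.y) X.y :=
  Function.rightInverse_invFun hX.surjective_y

/-- Where `y` is flat, `y_ξ = 0`, and the energy identity forces `U_ξ = 0`. This makes `u`
independent of the chosen preimage. -/
theorem U_eq_of_y_eq (hX : MemCalG χ X) (hχ : IsPartitionFunction χ) {ξ η : ℝ}
    (h : X.y ξ = X.y η) : X.U ξ = X.U η := by
  wlog hlt : ξ < η generalizing ξ η
  · rcases (not_lt.mp hlt).eq_or_lt with rfl | h'
    · rfl
    · exact (this h.symm h').symm
  obtain ⟨K, hK⟩ := hX.exists_lipschitzWith_U hχ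
  rw [eq_comm, ← sub_eq_zero, hK.isPrimitive.sub_eq]
  refine intervalIntegral.integral_zero_ae ?_
  filter_upwards [hX.energy_deriv hχ] with t ht htm
  rw [uIoc_of_le hlt.le] at htm
  have hy : X.y ξ = X.y t :=
    le_antisymm (hX.monotone_y htm.1.le) (h ▸ hX.monotone_y htm.2)
  rw [deriv_eq_zero_of_apply_eq hX.monotone_y htm.1.ne hy, zero_mul] at ht
  exact pow_eq_zero_iff two_ne_zero |>.mp ht.symm

theorem eulerVelocity_y (hX : MemCalG χ X) (hχ : IsPartitionFunction χ) (ξ : ℝ) :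
    X.eulerVelocity (X.y ξ) = X.U ξ :=
  hX.U_eq_of_y_eq hχ (hX.rightInverse_invFun _)

/-- If `y_ξ ≠ 0`, then `ξ` is the only preimage of `y ξ`, so `invFun` returns it; if `y_ξ = 0`, both
sides vanish by the energy identity. -/
theorem deriv_y_mul_eulerSlope (hX : MemCalG χ X) (hχ : IsPartitionFunction χ) :
    ∀ᵐ ξ, deriv X.y ξ * X.eulerSlope (X.y ξ) = deriv X.U ξ := by
  filter_upwards [hX.energy_deriv hχ] with ξ hξ
  by_cases h : deriv X.y ξ = 0
  · rw [h, zero_mul] at hξ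
    rw [h, zero_mul, (pow_eq_zero_iff two_ne_zero).mp hξ.symm]
  · have : Function.invFun X.y (X.y ξ) = ξ := by
      by_contra hne
      exact h (deriv_eq_zero_of_apply_eq hX.monotone_y hne (hX.rightInverse_invFun _))
    rw [Triple.eulerSlope, this]
    field_simp

theorem deriv_y_mul_eulerSlope_sq (hX : MemCalG χ X) (hχ : IsPartitionFunction χ) :
    ∀ᵐ ξ, deriv X.y ξ * X.eulerSlope (X.y ξ) ^ 2 =
      {ξ | deriv X.y ξ = 0}ᶜ.indicator X.h ξ := by
  filter_upwards [hX.energy_deriv hχ, hX.deriv_y_mul_eulerSlope hχ] with ξ h1 h2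
  by_cases h : deriv X.y ξ = 0
  · rw [indicator_of_notMem (by simpa using h), h, zero_mul]
  · rw [indicator_of_mem (by simpa using h)]
    rw [← h2] at h1
    refine mul_left_cancel₀ h ?_
    rw [h1]
    ring

theorem measurable_eulerSlope (hX : MemCalG χ X) : Measurable X.eulerSlope := by
  have hs := (monotone_of_rightInverse hX.monotone_y hX.rightInverse_invFun).measurable
  exact ((measurable_deriv _).comp hs).div ((measurable_deriv _).comp hs)

end MemCalG

namespace MemF

variable {χ : ℝ → ℝ} {X : Triple}

theorem memLp_eulerSlope (hX : MemF χ X) (hχ : IsPartitionFunction χ) :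
    MemLp X.eulerSlope 2 volume := by
  obtain ⟨K, hK⟩ := hX.1.exists_lipschitzWith_y
  rw [memLp_two_iff_lintegral hX.1.measurable_eulerSlope.aestronglyMeasurable,
    lintegral_eq_lintegral_comp hK hX.1.monotone_y hX.1.surjective_y]
  refine lt_of_le_of_lt (lintegral_mono_ae ?_)
    ((hasFiniteIntegral_iff_ofReal hX.1.h_nonneg).mp (hX.integrable_h hχ).2)
  filter_upwards [hX.1.deriv_y_mul_eulerSlope_sq hχ, hX.1.h_nonneg] with ξ h1 h2
  rw [← ENNReal.ofReal_mul hX.1.monotone_y.deriv_nonneg, h1]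
  exact ENNReal.ofReal_le_ofReal (indicator_le_self' (fun _ _ => h2) _)

theorem isPrimitive_eulerVelocity (hX : MemF χ X) (hχ : IsPartitionFunction χ) :
    IsPrimitive X.eulerVelocity X.eulerSlope := by
  obtain ⟨K, hK⟩ := hX.1.exists_lipschitzWith_y
  obtain ⟨K', hK'⟩ := hX.1.exists_lipschitzWith_U hχ
  have hr := hX.1.rightInverse_invFun
  have hm := monotone_of_rightInverse hX.1.monotone_y hr
  refine ⟨(hX.memLp_eulerSlope hχ).locallyIntegrable (by norm_num), fun a b => ?_⟩
  wlog hab : a ≤ b generalizing a b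
  · rw [intervalIntegral.integral_symm, ← this b a (not_le.mp hab).le]
    ring
  -- Substituting `x = y ξ` between preimages of `a` and `b` turns the integrand into `U_ξ`.
  have h1 := integral_comp_mul_deriv hK hX.1.monotone_y (hm hab) X.eulerSlope
  rw [hr, hr] at h1
  rw [h1, intervalIntegral.integral_congr_ae (g := deriv X.U)
    ((hX.1.deriv_y_mul_eulerSlope hχ).mono fun x hx _ => hx), ← hK'.isPrimitive.sub_eq]
  rfl

theorem memH0Inf_eulerVelocity (hX : MemF χ X) (hχ : IsPartitionFunction χ) :
    MemH0Inf χ X.eulerVelocity := by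
  obtain ⟨K, hK⟩ := hX.1.exists_lipschitzWith_y
  obtain ⟨C, hC⟩ := hX.1.exists_abs_sub_le
  have hp := hX.isPrimitive_eulerVelocity hχ
  obtain ⟨⟨c, hc⟩, -⟩ := hχ.memH0Inf_iff.mp hX.1.U_mem
  refine hχ.memH0Inf_iff.mpr ⟨⟨c, ?_⟩, _, hp, hX.memLp_eulerSlope hχ⟩
  refine memLp_of_memLp_comp hK hX.1.monotone_y hX.1.surjective_y
    (hp.continuous.sub (continuous_const.mul hχ.contDiff.continuous)).aestronglyMeasurable ?_
  -- Uses `u ∘ y - c χ ∘ y = (U - c χ) + c (χ - χ ∘ y)`; the last difference has compact support.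
  refine (memLp_congr_ae (ae_of_all _ fun ξ => ?_)).mp
    (hc.add ((hχ.memLp_sub_comp hX.1.continuous_y hC).const_mul c))
  simp only [Pi.add_apply, hX.1.eulerVelocity_y hχ]
  ring

theorem isFiniteMeasure_eulerMeasure (hX : MemF χ X) (hχ : IsPartitionFunction χ) :
    IsFiniteMeasure X.eulerMeasure := by
  have := isFiniteMeasure_withDensity_ofReal (hX.integrable_h hχ).2
  exact Measure.isFiniteMeasure_map _ _

/-- The Lebesgue decomposition of the energy measure. -/
theorem eulerMeasure_eq_add (hX : MemF χ X) (hχ : IsPartitionFunction χ) :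
    X.eulerMeasure = (volume.withDensity ({ξ | deriv X.y ξ = 0}.indicator
        fun ξ => ENNReal.ofReal (X.h ξ))).map X.y +
      volume.withDensity fun x => ENNReal.ofReal (X.eulerSlope x ^ 2) := by
  obtain ⟨K, hK⟩ := hX.1.exists_lipschitzWith_y
  rw [← map_withDensity_deriv_mul_comp hK hX.1.monotone_y hX.1.surjective_y
      fun x => ENNReal.ofReal (X.eulerSlope x ^ 2), ← Measure.map_add _ _ hX.1.continuous_y.measurable, Triple.eulerMeasure]
  congr 1
  rw [← withDensity_add_right _ ?_]
  · refine withDensity_congr_ae ?_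
    filter_upwards [hX.1.deriv_y_mul_eulerSlope_sq hχ] with ξ hξ
    rw [Pi.add_apply, ← ENNReal.ofReal_mul hX.1.monotone_y.deriv_nonneg, hξ]
    by_cases h : deriv X.y ξ = 0 <;> simp [h]
  · have := hX.1.measurable_eulerSlope
    have := hX.1.continuous_y.measurable
    fun_prop

theorem ac_part_eulerMeasure (hX : MemF χ X) (hχ : IsPartitionFunction χ) :
    volume.withDensity (X.eulerMeasure.rnDeriv volume) =
      volume.withDensity fun x => ENNReal.ofReal (weakDeriv X.eulerVelocity x ^ 2) := by
  obtain ⟨K, hK⟩ := hX.1.exists_lipschitzWith_y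
  have hg := hX.1.measurable_eulerSlope
  rw [← Measure.eq_withDensity_rnDeriv (by fun_prop) ?_ (hX.eulerMeasure_eq_add hχ)]
  · refine withDensity_congr_ae ?_
    filter_upwards [(hX.isPrimitive_eulerVelocity hχ).weakDeriv_ae_eq] with x hx
    rw [hx]
  -- The first summand is carried by this null set, hence singular.
  · set N := toMeasurable volume (X.y '' {ξ | deriv X.y ξ = 0})
    have hN : MeasurableSet N := measurableSet_toMeasurable _ _
    refine ⟨Nᶜ, hN.compl, ?_, ?_⟩
    · rw [Measure.map_apply hX.1.continuous_y.measurable hN.compl,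
        withDensity_apply _ (hX.1.continuous_y.measurable hN.compl),
        setLIntegral_congr_fun (g := fun _ => 0) (hX.1.continuous_y.measurable hN.compl)]
      · simp
      · intro ξ hξ
        exact indicator_of_notMem
          (fun h0 => hξ (subset_toMeasurable _ _ (mem_image_of_mem _ h0))) _
    · rw [compl_compl, measure_toMeasurable, volume_image_deriv_eq_zero hK hX.1.monotone_y]

end MemF

/-- The element of `𝒟` attached to an element of `ℱ`. -/
def Lagrangian.toEulerian {χ : ℝ → ℝ} (hχ : IsPartitionFunction χ) (X : Lagrangian χ) :
    Eulerian χ where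
  u := X.1.eulerVelocity
  μ := X.1.eulerMeasure
  u_mem := X.2.memH0Inf_eulerVelocity hχ
  finite := X.2.isFiniteMeasure_eulerMeasure hχ
  ac_part := X.2.ac_part_eulerMeasure hχ

theorem Eulerian.ext' {χ : ℝ → ℝ} {d d' : Eulerian χ} (hu : d.u = d'.u) (hμ : d.μ = d'.μ) :
    d = d' := by
  cases d; cases d'
  cases hu; cases hμ
  rfl

theorem Relabeled.toEulerian_eq {χ : ℝ → ℝ} (hχ : IsPartitionFunction χ) {X X' : Lagrangian χ}
    (h : Relabeled χ X X') : X.toEulerian hχ = X'.toEulerian hχ := by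
  obtain ⟨f, hf, hy, hU, hh⟩ := relabeled_iff.mp h
  obtain ⟨K, hK⟩ := hf.exists_lipschitzWith
  refine Eulerian.ext' (funext fun x => ?_) ?_
  · obtain ⟨ξ, rfl⟩ := X'.2.1.surjective_y x
    change X.1.eulerVelocity _ = X'.1.eulerVelocity _
    rw [X'.2.1.eulerVelocity_y hχ, hy, X.2.1.eulerVelocity_y hχ, hU]
  · change X.1.eulerMeasure = X'.1.eulerMeasure
    have hy' : X'.1.y = X.1.y ∘ f := funext hy
    rw [Triple.eulerMeasure, Triple.eulerMeasure, hy',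
      ← Measure.map_map X.2.1.continuous_y.measurable f.continuous.measurable,
      ← map_withDensity_deriv_mul_comp hK hf.strictMono.monotone f.surjective]
    congr 2
    refine withDensity_congr_ae ?_
    filter_upwards [hh] with ξ hξ
    rw [hξ, mul_comm, ENNReal.ofReal_mul' (hf.deriv_nonneg ξ)]

/-- Surjectivity of `y` means that the defining formulas fix `u` everywhere, whence uniqueness of
`M`. -/
theorem IsLagrangeToEuler.apply_mk {χ : ℝ → ℝ} (hχ : IsPartitionFunction χ)
    {M : LagrangianModG χ → Eulerian χ} (hM : IsLagrangeToEuler χ M) (X : Lagrangian χ) :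
    M (Quot.mk _ X) = X.toEulerian hχ := by
  refine Eulerian.ext' (funext fun x => ?_) (hM X).2
  obtain ⟨ξ, rfl⟩ := X.2.1.surjective_y x
  rw [(hM X).1 _ ξ rfl]
  exact (X.2.1.eulerVelocity_y hχ ξ).symm

theorem existsUnique_isLagrangeToEuler {χ : ℝ → ℝ} (hχ : IsPartitionFunction χ) :
    ∃! M : LagrangianModG χ → Eulerian χ, IsLagrangeToEuler χ M := by
  refine ⟨Quot.lift (Lagrangian.toEulerian hχ) fun X X' h => h.toEulerian_eq hχ, fun X => ⟨?_, rfl⟩,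
    fun M hM => funext fun q => ?_⟩
  · rintro _ ξ rfl
    exact X.2.1.eulerVelocity_y hχ ξ
  · induction q using Quot.ind with
    | mk X => exact hM.apply_mk hχ X

/-! ### The characteristic as a generalised inverse of a distribution function -/

section Characteristic

/-- The left-continuous distribution function of `μ + dx`. -/
def lowerDistrib (μ : Measure ℝ) (x : ℝ) : ℝ := μ.real (Iio x) + x

/-- The right-continuous distribution function of `μ + dx`. -/
def upperDistrib (μ : Measure ℝ) (x : ℝ) : ℝ := μ.real (Iic x) + x

variable (μ : Measure ℝ)

theorem le_lowerDistrib (x : ℝ) : x ≤ lowerDistrib μ x :=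
  le_add_of_nonneg_left measureReal_nonneg

variable [IsFiniteMeasure μ]

theorem lowerDistrib_le_upperDistrib (x : ℝ) : lowerDistrib μ x ≤ upperDistrib μ x :=
  add_le_add_left (measureReal_mono Iio_subset_Iic_self) _

theorem lowerDistrib_sub_upperDistrib {a b : ℝ} (hab : a < b) :
    lowerDistrib μ b - upperDistrib μ a = μ.real (Ioo a b) + (b - a) := by
  have h : μ.real (Iio b) = μ.real (Iic a) + μ.real (Ioo a b) := by
    rw [← Iic_union_Ioo_eq_Iio hab, measureReal_union
      (disjoint_left.mpr fun x (hx : x ∈ Iic a) (hx' : x ∈ Ioo a b) => not_lt.mpr hx hx'.1)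
      measurableSet_Ioo]
  rw [lowerDistrib, upperDistrib, h]
  ring

theorem upperDistrib_lt_lowerDistrib {a b : ℝ} (hab : a < b) :
    upperDistrib μ a < lowerDistrib μ b := by
  have h := lowerDistrib_sub_upperDistrib μ hab
  have : 0 ≤ μ.real (Ioo a b) := measureReal_nonneg
  linarith

theorem monotone_lowerDistrib : Monotone (lowerDistrib μ) := fun _ _ hab =>
  add_le_add (measureReal_mono (Iio_subset_Iio hab)) hab

theorem monotone_upperDistrib : Monotone (upperDistrib μ) := fun _ _ hab =>
  add_le_add (measureReal_mono (Iic_subset_Iic.mpr hab)) hab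

theorem upperDistrib_le (x : ℝ) : upperDistrib μ x ≤ μ.real univ + x :=
  add_le_add_left (measureReal_mono (subset_univ _)) _

theorem tendsto_measureReal_Iic_right (s : ℝ → Set ℝ) (hs : ∀ x, MeasurableSet (s x))
    (hm : Monotone s) {a : ℝ} (h1 : ∀ x, a < x → Iic a ⊆ s x) (h2 : ∀ x, s x ⊆ Iic x) :
    Tendsto (fun x => μ.real (s x)) (𝓝[>] a) (𝓝 (μ.real (Iic a))) := by
  have h := tendsto_measure_biInter_gt (μ := μ) (s := s) (a := a)
    (fun r _ => (hs r).nullMeasurableSet) (fun i j _ hij => hm hij)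
    ⟨a + 1, by simp, measure_ne_top _ _⟩
  have hI : ⋂ r > a, s r = Iic a := by
    refine Subset.antisymm (fun x hx => ?_) (subset_iInter₂ fun r hr => h1 r hr)
    simp only [mem_iInter] at hx
    exact le_of_forall_gt_imp_ge_of_dense fun r hr => h2 r (hx r hr)
  rw [hI] at h
  exact (ENNReal.tendsto_toReal (measure_ne_top _ _)).comp h

theorem tendsto_lowerDistrib_right (a : ℝ) :
    Tendsto (lowerDistrib μ) (𝓝[>] a) (𝓝 (upperDistrib μ a)) :=
  (tendsto_measureReal_Iic_right μ Iio (fun _ => measurableSet_Iio) (fun _ _ => Iio_subset_Iio)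
    (fun _ hx _ ht => lt_of_le_of_lt ht hx) fun _ => Iio_subset_Iic_self).add
    (tendsto_id.mono_left nhdsWithin_le_nhds)

theorem tendsto_upperDistrib_right (a : ℝ) :
    Tendsto (upperDistrib μ) (𝓝[>] a) (𝓝 (upperDistrib μ a)) :=
  (tendsto_measureReal_Iic_right μ Iic (fun _ => measurableSet_Iic)
    (fun _ _ => Iic_subset_Iic.mpr) (fun _ hx _ ht => le_trans ht hx.le) fun _ => Subset.rfl).add
    (tendsto_id.mono_left nhdsWithin_le_nhds)

theorem lowerDistrib_le_of_forall_lt {b c : ℝ} (h : ∀ x < b, lowerDistrib μ x ≤ c) :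
    lowerDistrib μ b ≤ c := by
  obtain ⟨v, hv, hvb, hvt⟩ := exists_seq_strictMono_tendsto b
  have hU : ⋃ n, Iio (v n) = Iio b := by
    refine Subset.antisymm (iUnion_subset fun n => Iio_subset_Iio (hvb n).le) fun x hx => ?_
    obtain ⟨n, hn⟩ := (hvt.eventually (lt_mem_nhds hx)).exists
    exact mem_iUnion.mpr ⟨n, hn⟩
  have h1 := tendsto_measure_iUnion_atTop (μ := μ) (s := fun n => Iio (v n))
    (fun m n hmn => Iio_subset_Iio (hv.monotone hmn))
  rw [hU] at h1
  have h2 : Tendsto (fun n => lowerDistrib μ (v n)) atTop (𝓝 (lowerDistrib μ b)) :=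
    ((ENNReal.tendsto_toReal (measure_ne_top _ _)).comp h1).add hvt
  exact le_of_tendsto' h2 fun n => h _ (hvb n)

/-- Left continuity of `lowerDistrib` gives the first bound at the supremum; its right limit is
`upperDistrib`, which gives the second. -/
theorem characteristic_spec (ξ : ℝ) :
    lowerDistrib μ (characteristic μ ξ) ≤ ξ ∧ ξ ≤ upperDistrib μ (characteristic μ ξ) := by
  have hne : {x : ℝ | μ.real (Iio x) + x < ξ}.Nonempty := by
    refine ⟨ξ - μ.real univ - 1, ?_⟩
    have := (lowerDistrib_le_upperDistrib μ (ξ - μ.real univ - 1)).trans (upperDistrib_le μ _)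
    rw [lowerDistrib] at this
    rw [mem_ofPred_eq]
    linarith
  have hbdd : BddAbove {x : ℝ | μ.real (Iio x) + x < ξ} :=
    ⟨ξ, fun x hx => (le_lowerDistrib μ x).trans (le_of_lt hx)⟩
  constructor
  · refine lowerDistrib_le_of_forall_lt μ fun x hx => ?_
    obtain ⟨x', hx', hlt⟩ := exists_lt_of_lt_csSup hne hx
    exact (monotone_lowerDistrib μ hlt.le).trans (le_of_lt hx')
  · refine ge_of_tendsto (tendsto_lowerDistrib_right μ _) ?_
    filter_upwards [self_mem_nhdsWithin] with x hx
    by_contra hcon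
    exact not_lt.mpr (le_csSup hbdd (not_le.mp hcon)) hx

variable {μ}

theorem characteristic_eq {ξ b : ℝ} (h1 : lowerDistrib μ b ≤ ξ) (h2 : ξ ≤ upperDistrib μ b) :
    characteristic μ ξ = b := by
  obtain ⟨h3, h4⟩ := characteristic_spec μ ξ
  rcases lt_trichotomy (characteristic μ ξ) b with h | h | h
  · linarith [upperDistrib_lt_lowerDistrib μ h]
  · exact h
  · linarith [upperDistrib_lt_lowerDistrib μ h]

theorem characteristic_lt_iff {ξ x : ℝ} : characteristic μ ξ < x ↔ ξ < lowerDistrib μ x := by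
  obtain ⟨h1, h2⟩ := characteristic_spec μ ξ
  constructor
  · exact fun h => h2.trans_lt (upperDistrib_lt_lowerDistrib μ h)
  · intro h
    by_contra hcon
    linarith [monotone_lowerDistrib μ (not_lt.mp hcon)]

theorem monotone_characteristic : Monotone (characteristic μ) := by
  intro ξ η h
  by_contra hcon
  have h1 := upperDistrib_lt_lowerDistrib μ (not_le.mp hcon)
  linarith [(characteristic_spec μ ξ).1, (characteristic_spec μ η).2]

/-- Length and energy strictly between two characteristics share the budget `η - ξ`. The Lipschitz
bounds for both `y` and `U` come from this. -/
theorem measureReal_Ioo_characteristic_le {ξ η : ℝ} (h : ξ ≤ η) :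
    μ.real (Ioo (characteristic μ ξ) (characteristic μ η)) +
      (characteristic μ η - characteristic μ ξ) ≤ η - ξ := by
  rcases (monotone_characteristic (μ := μ) h).eq_or_lt with he | hlt
  · rw [he]
    simpa using h
  · rw [← lowerDistrib_sub_upperDistrib μ hlt]
    linarith [(characteristic_spec μ ξ).2, (characteristic_spec μ η).1]

theorem lipschitzWith_characteristic : LipschitzWith 1 (characteristic μ) := by
  refine LipschitzWith.of_le_add_mul 1 fun η ξ => ?_
  rcases le_total ξ η with h | h
  · have h1 := measureReal_Ioo_characteristic_le (μ := μ) h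
    have h2 : 0 ≤ μ.real (Ioo (characteristic μ ξ) (characteristic μ η)) := measureReal_nonneg
    have h3 : η - ξ ≤ dist η ξ := le_abs_self _
    simp only [NNReal.coe_one, one_mul]
    linarith
  · have := monotone_characteristic (μ := μ) h
    have : 0 ≤ dist η ξ := dist_nonneg
    simp only [NNReal.coe_one, one_mul]
    linarith

theorem characteristic_le (ξ : ℝ) : characteristic μ ξ ≤ ξ :=
  (le_lowerDistrib μ _).trans (characteristic_spec μ ξ).1

theorem sub_characteristic_le (ξ : ℝ) :
    ξ - characteristic μ ξ ≤ μ.real (Iic (characteristic μ ξ)) := by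
  have := (characteristic_spec μ ξ).2
  rw [upperDistrib] at this
  linarith

theorem abs_characteristic_sub_le (ξ : ℝ) : |characteristic μ ξ - ξ| ≤ μ.real univ := by
  have h1 := characteristic_le (μ := μ) ξ
  have h2 := (sub_characteristic_le (μ := μ) ξ).trans (measureReal_mono (subset_univ _))
  rw [abs_le]
  constructor <;> linarith [measureReal_nonneg (μ := μ) (s := univ)]

theorem surjective_characteristic : Function.Surjective (characteristic μ) :=
  surjective_of_abs_sub_le lipschitzWith_characteristic.continuous abs_characteristic_sub_le

theorem map_characteristic_volume :
    (volume : Measure ℝ).map (characteristic μ) = volume + μ := by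
  have hmeas : Measurable (characteristic μ) := lipschitzWith_characteristic.continuous.measurable
  have key : ∀ a b, a < b → (volume : Measure ℝ).map (characteristic μ) (Ico a b) =
      (volume + μ : Measure ℝ) (Ico a b) := by
    intro a b hab
    -- Half-open intervals closed on the left match the left-continuous distribution function, so
    -- atoms are counted correctly.
    have hpre : characteristic μ ⁻¹' Ico a b = Ico (lowerDistrib μ a) (lowerDistrib μ b) := by
      ext ξ
      rw [mem_preimage, mem_Ico, mem_Ico, characteristic_lt_iff, ← not_lt, characteristic_lt_iff,
        not_lt]
    have h : lowerDistrib μ b - lowerDistrib μ a = (b - a) + μ.real (Ico a b) := by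
      have h : μ.real (Iio b) = μ.real (Iio a) + μ.real (Ico a b) := by
        rw [← Iio_union_Ico_eq_Iio hab.le, measureReal_union
          (disjoint_left.mpr fun x (hx : x ∈ Iio a) (hx' : x ∈ Ico a b) => not_lt.mpr hx'.1 hx)
          measurableSet_Ico]
      rw [lowerDistrib, lowerDistrib, h]
      ring
    rw [Measure.map_apply hmeas measurableSet_Ico, hpre, Real.volume_Ico, h, Measure.add_apply,
      Real.volume_Ico, ENNReal.ofReal_add (sub_nonneg.mpr hab.le) measureReal_nonneg,
      ofReal_measureReal]
  symm
  refine Measure.ext_of_Ico' _ _ (fun a b _ => ?_) fun a b hab => (key a b hab).symm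
  rw [Measure.add_apply]
  exact ENNReal.add_ne_top.mpr ⟨measure_Ico_lt_top.ne, measure_ne_top _ _⟩

theorem deriv_characteristic_mem_Icc (ξ : ℝ) : deriv (characteristic μ) ξ ∈ Icc (0 : ℝ) 1 := by
  refine ⟨monotone_characteristic.deriv_nonneg, (le_abs_self _).trans ?_⟩
  simpa using norm_deriv_le_of_lipschitz (lipschitzWith_characteristic (μ := μ)) (x₀ := ξ)

theorem isPrimitive_sub_characteristic :
    IsPrimitive (fun ξ => ξ - characteristic μ ξ) (fun ξ => 1 - deriv (characteristic μ) ξ) := by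
  have h : IsPrimitive (fun ξ : ℝ => ξ) (fun _ => 1) := ⟨locallyIntegrable_const _, by simp⟩
  exact h.sub lipschitzWith_characteristic.isPrimitive

theorem integrable_one_sub_deriv_characteristic :
    Integrable (fun ξ => 1 - deriv (characteristic μ) ξ) volume := by
  have hp := isPrimitive_sub_characteristic (μ := μ)
  refine integrable_of_intervalIntegral_norm_bounded (l := atTop) (a := fun n : ℕ => -(n : ℝ))
      (b := fun n : ℕ => (n : ℝ)) (μ.real univ) (fun n => ?_)
      (tendsto_neg_atTop_atBot.comp tendsto_natCast_atTop_atTop) tendsto_natCast_atTop_atTop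
      (Eventually.of_forall fun n => ?_)
  · exact (hp.intervalIntegrable _ _).1
  · simp only [Real.norm_of_nonneg (sub_nonneg.mpr (deriv_characteristic_mem_Icc (μ := μ) _).2)]
    rw [← hp.sub_eq]
    have h1 := characteristic_le (μ := μ) (-n)
    have h2 := abs_le.mp (abs_characteristic_sub_le (μ := μ) n)
    linarith

theorem tendsto_measureReal_Iic_atBot :
    Tendsto (fun x => μ.real (Iic x)) atBot (𝓝 0) := by
  have h := tendsto_measure_iInter_atBot (μ := μ) (s := Iic)
    (fun _ : ℝ => measurableSet_Iic.nullMeasurableSet) monotone_Iic ⟨0, measure_ne_top _ _⟩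
  have hI : ⋂ x : ℝ, Iic x = ∅ := by
    ext x
    simp only [mem_iInter, mem_Iic, mem_empty_iff_false, iff_false, not_forall, not_le]
    exact exists_lt x
  rw [hI, measure_empty] at h
  have h' := (ENNReal.tendsto_toReal ENNReal.zero_ne_top).comp h
  rw [ENNReal.toReal_zero] at h'
  exact h'

theorem integral_Iic_one_sub_deriv_characteristic (ξ : ℝ) :
    ∫ t in Iic ξ, (1 - deriv (characteristic μ) t) = ξ - characteristic μ ξ := by
  have hp := isPrimitive_sub_characteristic (μ := μ)
  have h1 := intervalIntegral_tendsto_integral_Iic ξ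
    (integrable_one_sub_deriv_characteristic (μ := μ)).integrableOn tendsto_id
  simp only [id, ← hp.sub_eq] at h1
  -- The boundary term at `-∞` is dominated by the mass of `μ` to the left of `y(a)`.
  have h2 : Tendsto (fun a => a - characteristic μ a) atBot (𝓝 0) := by
    refine squeeze_zero (fun a => sub_nonneg.mpr (characteristic_le a)) sub_characteristic_le ?_
    exact tendsto_measureReal_Iic_atBot.comp
      (tendsto_atBot_mono characteristic_le tendsto_id)
  have h3 := h2.const_sub (ξ - characteristic μ ξ)
  rw [sub_zero] at h3
  exact tendsto_nhds_unique h1 h3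

/-- The energy `1 - y_ξ` is transported to `μ`. -/
theorem map_withDensity_one_sub_deriv_characteristic :
    (volume.withDensity fun ξ => ENNReal.ofReal (1 - deriv (characteristic μ) ξ)).map
      (characteristic μ) = μ := by
  have hmeas : Measurable (characteristic μ) := lipschitzWith_characteristic.continuous.measurable
  have h := map_withDensity_deriv (lipschitzWith_characteristic (μ := μ)) monotone_characteristic
    surjective_characteristic
  refine (Measure.add_right_inj volume _ _).mp ?_
  calc volume + _ = (volume.withDensity fun ξ => ENNReal.ofReal (deriv (characteristic μ) ξ)).map
          (characteristic μ) + _ := by rw [h]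
    _ = (volume : Measure ℝ).map (characteristic μ) := by
      rw [← Measure.map_add _ _ hmeas, ← withDensity_add_right _ (by fun_prop)]
      congr 1
      refine (withDensity_congr_ae (ae_of_all _ fun ξ => ?_)).trans withDensity_one
      have h1 := deriv_characteristic_mem_Icc (μ := μ) ξ
      rw [Pi.add_apply, ← ENNReal.ofReal_add h1.1 (sub_nonneg.mpr h1.2)]
      simp
    _ = volume + μ := map_characteristic_volume

/-- The distribution function of `μ + dx` as a Stieltjes function. -/
def upperStieltjes (μ : Measure ℝ) [IsFiniteMeasure μ] : StieltjesFunction ℝ where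
  toFun := upperDistrib μ
  mono' := monotone_upperDistrib μ
  right_continuous' x :=
    continuousWithinAt_Ioi_iff_Ici.mp (tendsto_upperDistrib_right μ x)

theorem measure_upperStieltjes : (upperStieltjes μ).measure = μ + volume := by
  refine Measure.ext_of_Ioc _ _ fun a b hab => ?_
  have h : upperDistrib μ b - upperDistrib μ a = μ.real (Ioc a b) + (b - a) := by
    have h : μ.real (Iic b) = μ.real (Iic a) + μ.real (Ioc a b) := by
      rw [← Iic_union_Ioc_eq_Iic hab.le, measureReal_union
        (disjoint_left.mpr fun x (hx : x ∈ Iic a) (hx' : x ∈ Ioc a b) => not_lt.mpr hx hx'.1)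
        measurableSet_Ioc]
    rw [upperDistrib, upperDistrib, h]
    ring
  rw [StieltjesFunction.measure_Ioc, Measure.add_apply, Real.volume_Ioc]
  change ENNReal.ofReal (upperDistrib μ b - upperDistrib μ a) = _
  rw [h, ENNReal.ofReal_add measureReal_nonneg (sub_nonneg.mpr hab.le), ofReal_measureReal]

theorem ae_hasDerivAt_upperDistrib :
    ∀ᵐ x, HasDerivAt (upperDistrib μ) ((μ.rnDeriv volume x).toReal + 1) x := by
  have h1 := Measure.rnDeriv_add' μ volume (volume : Measure ℝ)
  have h2 := Measure.rnDeriv_self (volume : Measure ℝ)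
  filter_upwards [(upperStieltjes μ).ae_hasDerivAt, h1, h2, Measure.rnDeriv_lt_top μ volume]
    with x hx hx1 hx2 hx3
  rw [measure_upperStieltjes, hx1, Pi.add_apply, hx2,
    ENNReal.toReal_add hx3.ne ENNReal.one_ne_top, ENNReal.toReal_one] at hx
  exact hx

theorem upperDistrib_characteristic {ξ : ℝ}
    (hc : ContinuousAt (upperDistrib μ) (characteristic μ ξ)) :
    upperDistrib μ (characteristic μ ξ) = ξ := by
  obtain ⟨h1, h2⟩ := characteristic_spec μ ξ
  refine le_antisymm ?_ h2
  refine le_of_tendsto (hc.tendsto.mono_left (nhdsWithin_le_nhds (s := Iio (characteristic μ ξ)))) ?_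
  filter_upwards [self_mem_nhdsWithin] with x hx
  exact (upperDistrib_lt_lowerDistrib μ hx).le.trans h1

/-- Differentiates `characteristic μ ∘ upperDistrib μ = id`; continuity at `y ξ` rules out a jump,
so `upperDistrib` sends `y ξ` back to `ξ`. -/
theorem deriv_characteristic_mul {ξ d : ℝ} (hd : DifferentiableAt ℝ (characteristic μ) ξ)
    (h : HasDerivAt (upperDistrib μ) d (characteristic μ ξ)) :
    deriv (characteristic μ) ξ * d = 1 := by
  have hξ := upperDistrib_characteristic h.continuousAt
  have hcomp : HasDerivAt (characteristic μ ∘ upperDistrib μ) (deriv (characteristic μ) ξ * d)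
      (characteristic μ ξ) := HasDerivAt.comp _ (by rw [hξ]; exact hd.hasDerivAt) h
  have hid : characteristic μ ∘ upperDistrib μ = id := funext fun x =>
    characteristic_eq (lowerDistrib_le_upperDistrib μ x) le_rfl
  rw [hid] at hcomp
  exact hcomp.unique (hasDerivAt_id _)

end Characteristic

/-! ### From Eulerian to Lagrangian coordinates -/

namespace Eulerian

variable {χ : ℝ → ℝ} (d : Eulerian χ)

theorem isPrimitive_u (hχ : IsPartitionFunction χ) : IsPrimitive d.u (weakDeriv d.u) := by
  obtain ⟨-, g, hg, -⟩ := hχ.memH0Inf_iff.mp d.u_mem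
  exact hg.congr_ae hg.weakDeriv_ae_eq.symm

theorem memLp_weakDeriv_u (hχ : IsPartitionFunction χ) : MemLp (weakDeriv d.u) 2 volume := by
  obtain ⟨-, g, hg, hg2⟩ := hχ.memH0Inf_iff.mp d.u_mem
  exact (memLp_congr_ae hg.weakDeriv_ae_eq).mpr hg2

theorem setIntegral_weakDeriv_sq_le (hχ : IsPartitionFunction χ) (s : Set ℝ)
    (hs : MeasurableSet s) : ∫ x in s, weakDeriv d.u x ^ 2 ≤ d.μ.real s := by
  have := d.finite
  rw [← ENNReal.ofReal_le_ofReal_iff measureReal_nonneg, ofReal_measureReal,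
    ofReal_integral_eq_lintegral_ofReal (d.memLp_weakDeriv_u hχ).integrable_sq.integrableOn
      (ae_of_all _ fun x => sq_nonneg _), ← withDensity_apply _ hs, ← d.ac_part]
  exact Measure.withDensity_rnDeriv_le _ _ s

theorem rnDeriv_ae_eq (hχ : IsPartitionFunction χ) :
    ∀ᵐ x, (d.μ.rnDeriv volume x).toReal = weakDeriv d.u x ^ 2 := by
  have h := (withDensity_eq_iff_of_sigmaFinite (Measure.measurable_rnDeriv _ _).aemeasurable
    (d.memLp_weakDeriv_u hχ).integrable_sq.aemeasurable.ennreal_ofReal).mp d.ac_part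
  filter_upwards [h] with x hx
  rw [hx, ENNReal.toReal_ofReal (sq_nonneg _)]

/-- Cauchy-Schwarz combined with `u_x² dx ≤ μ`: an integrated form of `U_ξ² ≤ y_ξ (1 - y_ξ)`. -/
theorem sq_sub_comp_characteristic_le (hχ : IsPartitionFunction χ) (ξ η : ℝ) :
    (d.u (characteristic d.μ η) - d.u (characteristic d.μ ξ)) ^ 2 ≤
      (characteristic d.μ η - characteristic d.μ ξ) *
        ((η - ξ) - (characteristic d.μ η - characteristic d.μ ξ)) := by
  have := d.finite
  wlog h : ξ ≤ η generalizing ξ η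
  · have := this η ξ (not_le.mp h).le
    linarith
  have hab := monotone_characteristic (μ := d.μ) h
  refine ((d.isPrimitive_u hχ).sq_sub_le (d.memLp_weakDeriv_u hχ) hab).trans
    (mul_le_mul_of_nonneg_left ?_ (sub_nonneg.mpr hab))
  -- The open interval matters: atoms of `μ` at the endpoints need not fit into `η - ξ`.
  rw [intervalIntegral.integral_of_le hab, integral_Ioc_eq_integral_Ioo]
  have h1 := d.setIntegral_weakDeriv_sq_le hχ _
    (measurableSet_Ioo (a := characteristic d.μ ξ) (b := characteristic d.μ η))
  have h2 := measureReal_Ioo_characteristic_le (μ := d.μ) h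
  linarith

theorem lipschitzWith_comp_characteristic (hχ : IsPartitionFunction χ) :
    LipschitzWith 1 fun ξ => d.u (characteristic d.μ ξ) := by
  refine LipschitzWith.of_dist_le_mul fun η ξ => ?_
  rw [Real.dist_eq, Real.dist_eq, NNReal.coe_one, one_mul]
  have h := d.sq_sub_comp_characteristic_le hχ ξ η
  refine sq_le_sq.mp (h.trans ?_)
  nlinarith [sq_nonneg (characteristic d.μ η - characteristic d.μ ξ - (η - ξ)),
    sq_nonneg (characteristic d.μ η - characteristic d.μ ξ)]

theorem deriv_comp_characteristic_eq_zero (hχ : IsPartitionFunction χ) {ξ : ℝ}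
    (hy : DifferentiableAt ℝ (characteristic d.μ) ξ)
    (hU : DifferentiableAt ℝ (fun ξ => d.u (characteristic d.μ ξ)) ξ)
    (h0 : deriv (characteristic d.μ) ξ = 0) :
    deriv (fun ξ => d.u (characteristic d.μ ξ)) ξ = 0 := by
  have h1 := hasDerivAt_iff_tendsto_slope.mp hU.hasDerivAt
  have h2 := hasDerivAt_iff_tendsto_slope.mp hy.hasDerivAt
  rw [h0] at h2
  -- Dividing by `(η - ξ)²` bounds the squared slope of `U` by `q (1 - q)`, where the slope `q` of
  -- `y` tends to `0`.
  have h3 := le_of_tendsto_of_tendsto (h1.pow 2) (h2.mul (h2.const_sub 1)) (by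
    filter_upwards [self_mem_nhdsWithin] with η hη
    have hne : η - ξ ≠ 0 := sub_ne_zero.mpr hη
    have h := d.sq_sub_comp_characteristic_le hχ ξ η
    have hpos : 0 < (η - ξ) ^ 2 := by positivity
    simp only [slope_def_field]
    rw [div_pow, div_le_iff₀ hpos]
    refine h.trans_eq ?_
    field_simp)
  rw [zero_mul] at h3
  exact pow_eq_zero_iff two_ne_zero |>.mp (le_antisymm h3 (sq_nonneg _))

/-- The energy identity `y_ξ (1 - y_ξ) = U_ξ²`. -/
theorem ae_deriv_characteristic_mul_one_sub (hχ : IsPartitionFunction χ) :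
    ∀ᵐ ξ, deriv (characteristic d.μ) ξ * (1 - deriv (characteristic d.μ) ξ) =
      deriv (fun ξ => d.u (characteristic d.μ ξ)) ξ ^ 2 := by
  have := d.finite
  have hgood : ∀ᵐ x, HasDerivAt d.u (weakDeriv d.u x) x ∧
      HasDerivAt (upperDistrib d.μ) (weakDeriv d.u x ^ 2 + 1) x := by
    filter_upwards [(d.isPrimitive_u hχ).ae_hasDerivAt, ae_hasDerivAt_upperDistrib (μ := d.μ),
      d.rnDeriv_ae_eq hχ] with x h1 h2 h3
    rw [h3] at h2
    exact ⟨h1, h2⟩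
  filter_upwards [ae_deriv_eq_zero_of_mem_null (lipschitzWith_characteristic (μ := d.μ))
      monotone_characteristic (ae_iff.mp hgood),
    (lipschitzWith_characteristic (μ := d.μ)).ae_differentiableAt_real,
    (d.lipschitzWith_comp_characteristic hχ).ae_differentiableAt_real] with ξ h1 h2 h3
  by_cases h : deriv (characteristic d.μ) ξ = 0
  · rw [d.deriv_comp_characteristic_eq_zero hχ h2 h3 h, h]
    ring
  · obtain ⟨h4, h5⟩ := not_not.mp fun hn => h (h1 hn)
    have h6 := deriv_characteristic_mul h2 h5
    have h7 : deriv (fun ξ => d.u (characteristic d.μ ξ)) ξ =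
        weakDeriv d.u (characteristic d.μ ξ) * deriv (characteristic d.μ) ξ :=
      (h4.comp ξ h2.hasDerivAt).deriv
    rw [h7]
    linear_combination (-deriv (characteristic d.μ) ξ) * h6

/-- The image of `dξ` is `dx + μ`: square integrability handles `dx`, boundedness handles the finite
measure `μ`. -/
theorem memLp_comp_characteristic {v : ℝ → ℝ} (hv : Continuous v) {C : ℝ} (hC : ∀ x, |v x| ≤ C)
    (h2 : MemLp v 2 volume) : MemLp (fun ξ => v (characteristic d.μ ξ)) 2 volume := by
  have := d.finite
  have hmeas : Measurable (characteristic d.μ) :=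
    lipschitzWith_characteristic.continuous.measurable
  have h3 : MemLp v 2 ((volume : Measure ℝ).map (characteristic d.μ)) := by
    rw [map_characteristic_volume, memLp_two_iff_integrable_sq hv.aestronglyMeasurable,
      integrable_add_measure]
    exact ⟨h2.integrable_sq,
      (MemLp.of_bound (p := 2) hv.aestronglyMeasurable C (ae_of_all _ hC)).integrable_sq⟩
  exact h3.comp_of_map hmeas.aemeasurable

theorem toTriple_h_ae_eq : (toTriple d.u d.μ).h =ᵐ[volume]
    fun ξ => 1 - deriv (characteristic d.μ) ξ := by
  have := d.finite
  filter_upwards [(lipschitzWith_characteristic (μ := d.μ)).weakDeriv_ae_eq] with ξ hξ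
  simp only [toTriple, hξ]

theorem memLp_one_sub_deriv_characteristic :
    MemLp (fun ξ => 1 - deriv (characteristic d.μ) ξ) 2 volume := by
  have := d.finite
  have hi := integrable_one_sub_deriv_characteristic (μ := d.μ)
  rw [memLp_two_iff_integrable_sq hi.aestronglyMeasurable]
  refine hi.mono' (hi.aestronglyMeasurable.pow 2) (ae_of_all _ fun ξ => ?_)
  have h := deriv_characteristic_mem_Icc (μ := d.μ) ξ
  rw [Real.norm_of_nonneg (sq_nonneg _)]
  nlinarith [h.1, h.2]

theorem memH0Inf_comp_characteristic (hχ : IsPartitionFunction χ) :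
    MemH0Inf χ fun ξ => d.u (characteristic d.μ ξ) := by
  have := d.finite
  have hL := d.lipschitzWith_comp_characteristic hχ
  obtain ⟨v, c, ⟨hvc, hv, g, hg, hg2⟩, hu⟩ := d.u_mem
  obtain ⟨C, hC⟩ := exists_abs_le_of_memLp (hg.isPrimitive hvc) hv hg2
  refine hχ.memH0Inf_iff.mpr ⟨⟨c, ?_⟩, _, hL.isPrimitive, ?_⟩
  · refine (memLp_congr_ae (ae_of_all _ fun ξ => ?_)).mp
      ((d.memLp_comp_characteristic hvc hC hv).sub ((hχ.memLp_sub_comp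
        lipschitzWith_characteristic.continuous (abs_characteristic_sub_le (μ := d.μ))).const_mul c))
    simp only [Pi.sub_apply, hu]
    ring
  · have hi := integrable_one_sub_deriv_characteristic (μ := d.μ)
    have hm := (measurable_deriv fun ξ => d.u (characteristic d.μ ξ)).aestronglyMeasurable
      (μ := volume)
    rw [memLp_two_iff_integrable_sq hm]
    refine hi.mono' (hm.pow 2) ?_
    filter_upwards [d.ae_deriv_characteristic_mul_one_sub hχ] with ξ hξ
    have h := deriv_characteristic_mem_Icc (μ := d.μ) ξ
    rw [Real.norm_of_nonneg (sq_nonneg _), ← hξ]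
    exact mul_le_of_le_one_left (sub_nonneg.mpr h.2) h.2

theorem memCalG_toTriple (hχ : IsPartitionFunction χ) : MemCalG χ (toTriple d.u d.μ) := by
  have := d.finite
  have hL := lipschitzWith_characteristic (μ := d.μ)
  have hw := hL.weakDeriv_ae_eq
  have hU := d.lipschitzWith_comp_characteristic hχ
  have hW : MemW1Inf fun ξ => characteristic d.μ ξ - ξ :=
    (memW1Inf_sub_id_iff hL.continuous).mpr ⟨⟨_, abs_characteristic_sub_le⟩, _, hL⟩
  have hp : IsPrimitive (fun ξ => characteristic d.μ ξ - ξ)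
      fun ξ => -(1 - deriv (characteristic d.μ) ξ) := by
    simpa using (isPrimitive_sub_characteristic (μ := d.μ)).const_mul (-1)
  have hh := d.toTriple_h_ae_eq
  exact
    { zeta_mem := ⟨hL.continuous.sub continuous_id, hW.1, _, hp.hasWeakDeriv,
        d.memLp_one_sub_deriv_characteristic.neg⟩
      U_mem := d.memH0Inf_comp_characteristic hχ
      h_mem := (memLp_congr_ae hh).mpr d.memLp_one_sub_deriv_characteristic
      zeta_W1Inf := hW
      U_W1Inf := by
        obtain ⟨C, hC⟩ := hχ.exists_abs_le d.u_mem
        exact (memW1Inf_iff hU.continuous).mpr ⟨⟨C, fun ξ => hC _⟩, _, hU⟩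
      h_bounded := by
        refine (memLp_congr_ae hh).mpr (memLp_top_of_forall_abs_le (C := 1)
          d.memLp_one_sub_deriv_characteristic.aestronglyMeasurable fun ξ => ?_)
        have h := deriv_characteristic_mem_Icc (μ := d.μ) ξ
        rw [abs_le]
        constructor <;> linarith [h.1, h.2]
      y_deriv_nonneg := by
        filter_upwards [hw] with ξ h
        exact (deriv_characteristic_mem_Icc ξ).1.trans_eq h.symm
      h_nonneg := by
        filter_upwards [hh] with ξ h
        rw [h]
        exact sub_nonneg.mpr (deriv_characteristic_mem_Icc ξ).2
      add_pos := ae_of_all _ fun ξ => by simp [toTriple]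
      energy := by
        filter_upwards [hw, hh, hU.weakDeriv_ae_eq, d.ae_deriv_characteristic_mul_one_sub hχ]
          with ξ h1 h2 h3 h4
        change weakDeriv (characteristic d.μ) ξ * _ =
          weakDeriv (fun ξ => d.u (characteristic d.μ ξ)) ξ ^ 2
        rw [h1, h2, h3, h4] }

theorem memF_toTriple (hχ : IsPartitionFunction χ) : MemF χ (toTriple d.u d.μ) := by
  have := d.finite
  refine ⟨d.memCalG_toTriple hχ, Homeomorph.refl ℝ, .refl, fun ξ => ?_⟩
  rw [integral_congr_ae (ae_restrict_of_ae d.toTriple_h_ae_eq),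
    integral_Iic_one_sub_deriv_characteristic]
  simp [toTriple]

/-- The element of `ℱ` attached to an element of `𝒟`. -/
def toLagrangian (hχ : IsPartitionFunction χ) : Lagrangian χ :=
  ⟨toTriple d.u d.μ, d.memF_toTriple hχ⟩

theorem toEulerian_toLagrangian (hχ : IsPartitionFunction χ) :
    (d.toLagrangian hχ).toEulerian hχ = d := by
  have := d.finite
  refine Eulerian.ext' (funext fun x => ?_) ?_
  · obtain ⟨ξ, rfl⟩ := surjective_characteristic (μ := d.μ) x
    exact (d.memCalG_toTriple hχ).eulerVelocity_y hχ ξ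
  · refine Eq.trans ?_ (map_withDensity_one_sub_deriv_characteristic (μ := d.μ))
    change Measure.map (characteristic d.μ) _ = _
    congr 1
    refine withDensity_congr_ae ?_
    filter_upwards [d.toTriple_h_ae_eq] with ξ hξ
    exact congrArg ENNReal.ofReal hξ

end Eulerian

/-! ### Recovering a Lagrangian triple up to relabeling -/

namespace MemF

variable {χ : ℝ → ℝ} {X : Triple}

/-- Since `{y < y ξ} ⊆ Iic ξ ⊆ {y ≤ y ξ}`, the energy `H ξ` lies between the masses of `Iio (y ξ)`
and `Iic (y ξ)`. -/
theorem characteristic_eulerMeasure (hX : MemF χ X) (hχ : IsPartitionFunction χ) (ξ : ℝ) :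
    characteristic X.eulerMeasure (X.y ξ + ∫ t in Iic ξ, X.h t) = X.y ξ := by
  have := hX.isFiniteMeasure_eulerMeasure hχ
  have hm := hX.1.continuous_y.measurable
  have hH : ENNReal.ofReal (∫ t in Iic ξ, X.h t) =
      (volume.withDensity fun ξ => ENNReal.ofReal (X.h ξ)) (Iic ξ) := by
    rw [ofReal_integral_eq_lintegral_ofReal (hX.integrable_h hχ).integrableOn
      (ae_restrict_of_ae hX.1.h_nonneg), withDensity_apply _ measurableSet_Iic]
  have h0 : 0 ≤ ∫ t in Iic ξ, X.h t :=
    integral_nonneg_of_ae (ae_restrict_of_ae hX.1.h_nonneg)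
  refine characteristic_eq ?_ ?_
  · rw [lowerDistrib, add_comm]
    refine add_le_add_right ?_ _
    rw [← ENNReal.ofReal_le_ofReal_iff h0, ofReal_measureReal, hH, Triple.eulerMeasure,
      Measure.map_apply hm measurableSet_Iio]
    refine measure_mono fun η hη => ?_
    by_contra hcon
    exact not_lt.mpr (hX.1.monotone_y (not_le.mp hcon).le) hη
  · rw [upperDistrib, add_comm]
    refine add_le_add_left ?_ _
    rw [← ENNReal.ofReal_le_ofReal_iff measureReal_nonneg, ofReal_measureReal, hH,
      Triple.eulerMeasure, Measure.map_apply hm measurableSet_Iic]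
    exact measure_mono fun η hη => hX.1.monotone_y hη

theorem isPrimitive_add_integral (hX : MemF χ X) (hχ : IsPartitionFunction χ) :
    IsPrimitive (fun ξ => X.y ξ + ∫ t in Iic ξ, X.h t) fun ξ => deriv X.y ξ + X.h ξ := by
  obtain ⟨K, hK⟩ := hX.1.exists_lipschitzWith_y
  have hi := hX.integrable_h hχ
  exact hK.isPrimitive.add ⟨hi.locallyIntegrable, fun a b =>
    intervalIntegral.integral_Iic_sub_Iic hi.integrableOn hi.integrableOn⟩

end MemF

theorem relabeled_toLagrangian_toEulerian {χ : ℝ → ℝ} (hχ : IsPartitionFunction χ)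
    (X : Lagrangian χ) : Relabeled χ ((X.toEulerian hχ).toLagrangian hχ) X := by
  obtain ⟨X, hX⟩ := X
  obtain ⟨-, f, hf, hfy⟩ := id hX
  have := hX.isFiniteMeasure_eulerMeasure hχ
  have hy : ∀ ξ, characteristic X.eulerMeasure (f ξ) = X.y ξ := fun ξ => by
    rw [hfy, hX.characteristic_eulerMeasure hχ]
  refine relabeled_iff.mpr ⟨f, hf, fun ξ => (hy ξ).symm, fun ξ => ?_, ?_⟩
  · change X.U ξ = X.eulerVelocity (characteristic X.eulerMeasure (f ξ))
    rw [hy, hX.1.eulerVelocity_y hχ]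
  · have hp := hX.isPrimitive_add_integral hχ
    rw [← show (f : ℝ → ℝ) = _ from funext hfy] at hp
    -- Differentiating `characteristic ∘ f = y` turns `(1 - characteristic' ∘ f) f'` into `f' -
    -- y_ξ`, which is `h` because `f = y + H`.
    filter_upwards [hf.ae_comp ((Lagrangian.toEulerian hχ ⟨X, hX⟩).toTriple_h_ae_eq),
      hf.ae_deriv_comp (lipschitzWith_characteristic (μ := X.eulerMeasure)), hp.deriv_ae_eq]
      with ξ h1 h2 h3
    change X.h ξ = (toTriple X.eulerVelocity X.eulerMeasure).h (f ξ) * deriv f ξ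
    rw [show (fun ξ => characteristic X.eulerMeasure (f ξ)) = X.y from funext hy] at h2
    have h1' : (toTriple X.eulerVelocity X.eulerMeasure).h (f ξ) =
      1 - deriv (characteristic X.eulerMeasure) (f ξ) := h1
    rw [h1', sub_mul, ← h2, h3]
    ring

theorem existsUnique_isEulerToLagrange {χ : ℝ → ℝ} (hχ : IsPartitionFunction χ) :
    ∃! L : Eulerian χ → LagrangianModG χ, IsEulerToLagrange χ L :=
  ⟨fun d => Quot.mk _ (d.toLagrangian hχ), fun d => ⟨d.memF_toTriple hχ, rfl⟩,
    fun _ hL => funext fun d => (hL d).choose_spec⟩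

theorem IsEulerToLagrange.apply {χ : ℝ → ℝ} (hχ : IsPartitionFunction χ)
    {L : Eulerian χ → LagrangianModG χ} (hL : IsEulerToLagrange χ L) (d : Eulerian χ) :
    L d = Quot.mk _ (d.toLagrangian hχ) :=
  (hL d).choose_spec

end CamassaHolm

end

/-- Relabeling is an equivalence relation on `ℱ`, the maps `L` and `M` are well defined by their
defining formulas, and they are inverse to each other. -/
theorem mainTheorem6 (χ : ℝ → ℝ) (hχ : CamassaHolm.IsPartitionFunction χ) :
    Equivalence (CamassaHolm.Relabeled χ) ∧
    (∃! L : CamassaHolm.Eulerian χ → CamassaHolm.LagrangianModG χ,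
      CamassaHolm.IsEulerToLagrange χ L) ∧
    (∃! M : CamassaHolm.LagrangianModG χ → CamassaHolm.Eulerian χ,
      CamassaHolm.IsLagrangeToEuler χ M) ∧
    ∀ (L : CamassaHolm.Eulerian χ → CamassaHolm.LagrangianModG χ)
      (M : CamassaHolm.LagrangianModG χ → CamassaHolm.Eulerian χ),
      CamassaHolm.IsEulerToLagrange χ L → CamassaHolm.IsLagrangeToEuler χ M →
        L ∘ M = id ∧ M ∘ L = id := by
  refine ⟨CamassaHolm.equivalence_relabeled χ, CamassaHolm.existsUnique_isEulerToLagrange hχ,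
    CamassaHolm.existsUnique_isLagrangeToEuler hχ, fun L M hL hM => ⟨?_, ?_⟩⟩
  · funext q
    induction q using Quot.ind with
    | mk X =>
      change L (M (Quot.mk _ X)) = Quot.mk _ X
      rw [hM.apply_mk hχ, hL.apply hχ]
      exact Quot.sound (CamassaHolm.relabeled_toLagrangian_toEulerian hχ X)
  · funext d
    change M (L d) = d
    rw [hL.apply hχ, hM.apply_mk hχ, d.toEulerian_toLagrangian hχ]
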